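/- Write $\widehat{\mathbb N}_{\ge k}=\{k,k+1,\dots\}\cup\{\infty\}$ and let $[a,b]_k=aba\cdots$ denote the alternating product with $k$ factors. A Dyer graph $\Gamma=(\Gamma,f,m)$ is a finite simple graph with vertex weights $f:V(\Gamma)\to\widehat{\mathbb N}_{\ge 2}$ and edge weights $m:E(\Gamma)\to\widehat{\mathbb N}_{\ge 3}$ such that $m(\{u,v\})=\infty$ for every edge $\{u,v\}$ with $f(u)\ge 3$ or $f(v)\ge 3$. A marked Dyer system $(D,S)$ with associated Dyer graph $\Gamma$, $V(\Gamma)=(v_1,\dots,v_n)$, is a group $D$ with an ordered generating family $S=(s_1,\dots,s_n)$ such that $D$ has on these generators the presentation with relations $s_i^{f(v_i)}=1$ if $f(v_i)<\infty$; $s_is_j=s_js_i$ if $i\ne j$ and $\{v_i,v_j\}\notin E(\Gamma)$; and $[s_i,s_j]_k=[s_j,s_i]_k$ if $\{v_i,v_j\}\in E(\Gamma)$ and $k=m(\{v_i,v_j\})<\infty$. For $m\ge 0$ let $a_{(D,S)}(m)$ (respectively $b_{(D,S)}(m)$) be the number of elements of $D$ whose word length with respect to $S\cup S^{-1}$ is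 exactly (respectively at most) $m$, and let $\tau(D,S)=\lim_{m\to\infty} b_{(D,S)}(m)^{1/m}$ be the growth rate (the limit exists by submultiplicativity of $b_{(D,S)}$). Theorem. Let $(D,S)$ and $(D',S')$ be marked Dyer systems (possibly of different ranks $n$, $n'$) with associated Dyer graphs $(\Gamma,f,m)$ and $(\Gamma',f',m')$, and suppose that $(D,S)\preceq(D',S')$, that is, there is an injective map $\phi:V(\Gamma)\to V(\Gamma')$ sending edges to edges, with $f(v)\le f'(\phi(v))$ for every vertex $v$ of $\Gamma$ and $m(\{v,w\})\le m'(\{\phi(v),\phi(w)\})$ for every edge $\{v,w\}$ of $\Gamma$. Then $a_{(D,S)}(m)\le a_{(D',S')}(m)$ for every integer $m\ge 0$. In particular, $\tau(D,S)\le\tau(D',S')$. -/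

import Mathlib

open Filter Topology

universe u v

noncomputable section

/-! ### Word length, growth functions and growth rate of a marked group

A marked group is a group `G` together with an ordered finite family `s : Fin n → G` that
generates it. -/

namespace Marked

variable {G : Type u} [Group G] {n : ℕ}

/-- `l` is a word in the letters `s i` and `(s i)⁻¹` that represents `x`. -/
def IsWordFor (s : Fin n → G) (l : List G) (x : G) : Prop :=
  (∀ y ∈ l, y ∈ Set.range s ∨ y⁻¹ ∈ Set.range s) ∧ l.prod = x

/-- The word length of `x`: the least length of a word in `S ∪ S⁻¹` that represents `x`. -/
def wordLength (s : Fin n → G) (x : G) : ℕ :=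
  sInf {k | ∃ l : List G, IsWordFor s l x ∧ l.length = k}

/-- The ball of radius `m` about `1` in the word metric. -/
def ball (s : Fin n → G) (m : ℕ) : Set G := {x | wordLength s x ≤ m}

/-- `a(m)`: the number of elements of word length exactly `m`. -/
def sphereCount (s : Fin n → G) (m : ℕ) : ℕ := Set.ncard {x : G | wordLength s x = m}

/-- The growth function `b(m)`: the number of elements of word length at most `m`. -/
def ballCount (s : Fin n → G) (m : ℕ) : ℕ := (ball s m).ncard

/-- The growth rate `τ = lim b(m) ^ (1 / m)`. The limit exists for every generating family:
see `Marked.tendsto_growthRate`. -/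
def growthRate (s : Fin n → G) : ℝ :=
  limUnder atTop fun m : ℕ => (ballCount s m : ℝ) ^ (1 / (m : ℝ))

theorem wordLength_le_length {s : Fin n → G} {l : List G} {x : G} (h : IsWordFor s l x) :
    wordLength s x ≤ l.length :=
  Nat.sInf_le ⟨l, h, rfl⟩

theorem exists_word {s : Fin n → G} (hs : Subgroup.closure (Set.range s) = ⊤) (x : G) :
    ∃ l : List G, IsWordFor s l x ∧ l.length = wordLength s x := by
  have hx : x ∈ Subgroup.closure (Set.range s) := hs ▸ Subgroup.mem_top x
  rw [← Subgroup.mem_toSubmonoid, Subgroup.closure_toSubmonoid] at hx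
  obtain ⟨l, hl, hp⟩ := Submonoid.exists_list_of_mem_closure hx
  exact Nat.sInf_mem (s := {k | ∃ l : List G, IsWordFor s l x ∧ l.length = k})
    ⟨l.length, l, ⟨hl, hp⟩, rfl⟩

theorem one_mem_ball (s : Fin n → G) (m : ℕ) : (1 : G) ∈ ball s m := by
  have h : IsWordFor s [] (1 : G) := ⟨by simp, by simp⟩
  exact (wordLength_le_length h).trans (Nat.zero_le m)

open scoped Pointwise in
theorem ball_add_subset {s : Fin n → G} (hs : Subgroup.closure (Set.range s) = ⊤) (p q : ℕ) :
    ball s (p + q) ⊆ ball s p * ball s q := by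
  intro x hx
  obtain ⟨l, ⟨hl, hp⟩, hlen⟩ := exists_word hs x
  have hx' : l.length ≤ p + q := hlen ▸ hx
  refine Set.mem_mul.2 ⟨(l.take p).prod, ?_, (l.drop p).prod, ?_, ?_⟩
  · exact (wordLength_le_length (l := l.take p)
      ⟨fun y hy => hl y (List.mem_of_mem_take hy), rfl⟩).trans (by simp)
  · exact (wordLength_le_length (l := l.drop p)
      ⟨fun y hy => hl y (List.mem_of_mem_drop hy), rfl⟩).trans (by simp; omega)
  · rw [List.prod_take_mul_prod_drop, hp]

open scoped Pointwise in
theorem finite_ball {s : Fin n → G} (hs : Subgroup.closure (Set.range s) = ⊤) (m : ℕ) :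
    (ball s m).Finite := by
  have h0 : (ball s 0).Finite := by
    refine (Set.finite_singleton (1 : G)).subset fun x hx => ?_
    obtain ⟨l, ⟨hl, hp⟩, hlen⟩ := exists_word hs x
    have : l = [] := List.eq_nil_of_length_eq_zero (by rw [hlen]; exact Nat.le_zero.1 hx)
    subst this
    simpa using hp.symm
  have h1 : (ball s 1).Finite := by
    refine (h0.union ((Set.finite_range s).union (Set.finite_range s).inv)).subset fun x hx => ?_
    obtain ⟨l, ⟨hl, hp⟩, hlen⟩ := exists_word hs x
    have hx1 : wordLength s x ≤ 1 := hx
    rcases Nat.le_one_iff_eq_zero_or_eq_one.1 hx1 with h | h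
    · exact Or.inl h.le
    · obtain ⟨a, rfl⟩ := List.length_eq_one_iff.1 (hlen.trans h)
      right
      have := hl a (by simp)
      simp only [List.prod_singleton] at hp
      subst hp
      exact this
  induction m with
  | zero => exact h0
  | succ k ih => exact (ih.mul h1).subset (ball_add_subset hs k 1)

/-- The limit that defines the growth rate exists. -/
theorem tendsto_growthRate {s : Fin n → G} (hs : Subgroup.closure (Set.range s) = ⊤) :
    Tendsto (fun m : ℕ => (ballCount s m : ℝ) ^ (1 / (m : ℝ))) atTop (𝓝 (growthRate s)) := by
  have hpos : ∀ m, 1 ≤ ballCount s m := fun m =>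
    (Set.ncard_pos (finite_ball hs m)).2 ⟨1, one_mem_ball s m⟩
  have hpos' : ∀ m, (0 : ℝ) < ballCount s m := fun m => by exact_mod_cast hpos m
  have hmul : ∀ p q, ballCount s (p + q) ≤ ballCount s p * ballCount s q := fun p q =>
    (Set.ncard_le_ncard (ball_add_subset hs p q) ((finite_ball hs p).mul (finite_ball hs q))).trans
      (Set.natCard_mul_le)
  have hsub : Subadditive fun m => Real.log (ballCount s m) := fun p q => by
    rw [← Real.log_mul (hpos' p).ne' (hpos' q).ne']
    exact Real.log_le_log (hpos' _) (by exact_mod_cast hmul p q)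
  have hbdd : BddBelow (Set.range fun m : ℕ => Real.log (ballCount s m) / m) := by
    refine ⟨0, ?_⟩
    rintro _ ⟨m, rfl⟩
    exact div_nonneg (Real.log_nonneg (by exact_mod_cast hpos m)) (Nat.cast_nonneg m)
  refine tendsto_nhds_limUnder ⟨Real.exp hsub.lim, ?_⟩
  refine ((Real.continuous_exp.tendsto _).comp (hsub.tendsto_lim hbdd)).congr fun m => ?_
  rw [Real.rpow_def_of_pos (hpos' m)]
  simp [div_eq_mul_inv]

end Marked

/-! ### Dyer graphs and Dyer systems -/

/-- The alternating product `[a, b]_k = a b a ⋯` with `k` factors. -/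
def alternatingProd {G : Type u} [Group G] (a b : G) : ℕ → G
  | 0 => 1
  | k + 1 => a * alternatingProd b a k

/-- A Dyer graph on the vertex set `V`: a simple graph with vertex weights in `{2, 3, …, ∞}` and
edge weights in `{3, 4, …, ∞}`, where every edge with an endpoint of weight at least `3` has
weight `∞`. -/
structure DyerGraph (V : Type u) where
  /-- the underlying simple graph -/
  graph : SimpleGraph V
  /-- the vertex weight -/
  vertexWeight : V → ℕ∞
  /-- the edge weight -/
  edgeWeight : graph.edgeSet → ℕ∞
  two_le_vertexWeight : ∀ v, 2 ≤ vertexWeight v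
  three_le_edgeWeight : ∀ e, 3 ≤ edgeWeight e
  edgeWeight_eq_top : ∀ (e : graph.edgeSet) (v : V), v ∈ (e : Sym2 V) → 3 ≤ vertexWeight v →
    edgeWeight e = ⊤

namespace DyerGraph

variable {V : Type u} (Γ : DyerGraph V)

/-- The relators of the Dyer group: `v ^ f(v)` for a finite vertex weight `f(v)`,
`[u, v]_2 = [v, u]_2` for distinct non-adjacent `u`, `v`, and `[u, v]_k = [v, u]_k` for an edge
`{u, v}` of finite weight `k`. Infinite weights give no relator. -/
def relators : Set (FreeGroup V) :=
  {r | ∃ (v : V) (k : ℕ), Γ.vertexWeight v = k ∧ r = FreeGroup.of v ^ k} ∪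
  {r | ∃ u v : V, u ≠ v ∧ ¬ Γ.graph.Adj u v ∧
    r = alternatingProd (FreeGroup.of u) (FreeGroup.of v) 2 *
      (alternatingProd (FreeGroup.of v) (FreeGroup.of u) 2)⁻¹} ∪
  {r | ∃ (u v : V) (h : Γ.graph.Adj u v) (k : ℕ), Γ.edgeWeight ⟨s(u, v), h⟩ = k ∧
    r = alternatingProd (FreeGroup.of u) (FreeGroup.of v) k *
      (alternatingProd (FreeGroup.of v) (FreeGroup.of u) k)⁻¹}

/-- The Dyer group `D(Γ)`. -/
abbrev dyerGroup : Type u := PresentedGroup Γ.relators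

/-- `Γ` is the Dyer graph associated with `(D, S)`, `S = (s_v)_v`: the map `v ↦ s_v` extends to an
isomorphism of `D(Γ)` onto `D`. -/
def IsAssociatedWith {D : Type v} [Group D] (s : V → D) : Prop :=
  ∃ e : Γ.dyerGroup ≃* D, ∀ i : V, e (PresentedGroup.of i) = s i

end DyerGraph

/-- `(D, S)` with `S = (s_1, …, s_n)` is a marked Dyer system. -/
def IsMarkedDyerSystem {D : Type u} [Group D] {n : ℕ} (s : Fin n → D) : Prop :=
  ∃ Γ : DyerGraph (Fin n), Γ.IsAssociatedWith s

/-- The relation on Dyer graphs: there is an injective graph morphism along which vertex weights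
and edge weights do not decrease. -/
def DyerGraph.LE {V : Type u} {V' : Type v} (Γ : DyerGraph V) (Γ' : DyerGraph V') : Prop :=
  ∃ φ : Γ.graph →g Γ'.graph, Function.Injective φ ∧
    (∀ x, Γ.vertexWeight x ≤ Γ'.vertexWeight (φ x)) ∧
    (∀ e, Γ.edgeWeight e ≤ Γ'.edgeWeight (φ.mapEdgeSet e))

/-- The relation `(D, S) ⪯ (D', S')`: it holds between the associated Dyer graphs. -/
def DyerLE {D : Type u} {D' : Type v} [Group D] [Group D'] {n n' : ℕ}
    (s : Fin n → D) (s' : Fin n' → D') : Prop :=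
  ∃ (Γ : DyerGraph (Fin n)) (Γ' : DyerGraph (Fin n')),
    Γ.IsAssociatedWith s ∧ Γ'.IsAssociatedWith s' ∧ Γ.LE Γ'

/-- The marking of a Dyer system generates the group. -/
theorem IsMarkedDyerSystem.closure_range {D : Type u} [Group D] {n : ℕ} {s : Fin n → D}
    (h : IsMarkedDyerSystem s) : Subgroup.closure (Set.range s) = ⊤ := by
  obtain ⟨Γ, e, he⟩ := h
  have hr : Set.range s = e.toMonoidHom '' Set.range (PresentedGroup.of (rels := Γ.relators)) := by
    rw [← Set.range_comp]
    exact congrArg Set.range (funext fun i => (he i).symm)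
  rw [hr, ← MonoidHom.map_closure, PresentedGroup.closure_range_of]
  exact Subgroup.map_top_of_surjective _ e.surjective

end

-- The proof is a Tits-style solution of the word problem for Dyer groups, carried across the
-- comparison of graphs. An element is written as a word in syllables `s v ^ a`, with `a` nonzero of
-- least absolute value modulo the order of `s v`, and a word is minimal if it has the fewest
-- syllables.
--
-- Two tools control minimal words. The first is a cocycle, `exists_cocycle`, on `D` with values in
-- functions `D → ZMod k`: it records, for each reflection (conjugate of a generator of order `k`),
-- the total exponent with which it occurs. In a shortest word every reflection occurs at most once,
-- so the cocycle depends only on the element and yet reads off single exponents; this gives an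
-- exchange condition. The second is a reflection representation with generic entries,
-- `alternatingProd_ne`, which shows that alternating products shorter than the label are really
-- different. Together they give `reflTransGen_of_wordProd_eq`: two minimal words of an element
-- differ by moves that replace `[x, y]_k` by `[y, x]_k`, with `k` the label. These moves preserve
-- the sum of the absolute exponents, and this sum is the word length.
--
-- Now relabel a minimal word of the smaller group by `φ`. A move available in the larger graph uses
-- an alternating subword whose length is the larger label; a shortest word has none longer than the
-- smaller label, so the two labels agree and the move already exists in the smaller graph
-- (`exists_of_braidStep`). Hence relabelling preserves minimality (`isMinimal_map`) and does not
-- identify distinct elements (`wordProd_eq_of_map`). Choosing a minimal word for each element gives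
-- a length-preserving injection `D → D'`.

universe w

noncomputable section

/-! ### Alternating products, in particular of involutions. -/

section AlternatingProd

variable {G : Type u} [Group G]

@[simp] theorem alternatingProd_zero (a b : G) : alternatingProd a b 0 = 1 := rfl

theorem alternatingProd_succ (a b : G) (k : ℕ) :
    alternatingProd a b (k + 1) = a * alternatingProd b a k := rfl

theorem map_alternatingProd {H : Type v} [Group H] (F : G →* H) (a b : G) (k : ℕ) :
    F (alternatingProd a b k) = alternatingProd (F a) (F b) k := by
  induction k generalizing a b with
  | zero => simp
  | succ k ih => simp [alternatingProd_succ, ih]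

theorem alternatingProd_two_mul (a b : G) (i : ℕ) : alternatingProd a b (2 * i) = (a * b) ^ i := by
  induction i with
  | zero => simp
  | succ i ih =>
    rw [mul_add, mul_one, alternatingProd_succ, alternatingProd_succ, ih, pow_succ', mul_assoc]

theorem alternatingProd_two_mul_add_one (a b : G) (i : ℕ) :
    alternatingProd a b (2 * i + 1) = (a * b) ^ i * a := by
  rw [alternatingProd_succ, alternatingProd_two_mul]
  induction i with
  | zero => simp
  | succ i ih => rw [pow_succ', pow_succ', mul_assoc, mul_assoc, mul_assoc, ← ih]

theorem alternatingProd_two_mul_add_one_mul (a b : G) (i : ℕ) :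
    alternatingProd a b (2 * i + 1) * b = alternatingProd a b (2 * i + 2) := by
  rw [alternatingProd_two_mul_add_one, show 2 * i + 2 = 2 * (i + 1) by ring,
    alternatingProd_two_mul, pow_succ, mul_assoc]

theorem inv_mul_pow_of_involutive {a b : G} (ha : a * a = 1) (hb : b * b = 1) (i : ℕ) :
    ((a * b) ^ i)⁻¹ = (b * a) ^ i := by
  rw [← inv_pow, mul_inv_rev, inv_eq_of_mul_eq_one_right ha, inv_eq_of_mul_eq_one_right hb]

/-- For involutions, the braid relation of length `m` says that `(a b) ^ m = 1`. -/
theorem alternatingProd_eq_iff {a b : G} (ha : a * a = 1) (hb : b * b = 1) (m : ℕ) :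
    alternatingProd a b m = alternatingProd b a m ↔ (a * b) ^ m = 1 := by
  obtain ⟨i, rfl | rfl⟩ := Nat.even_or_odd' m
  · rw [alternatingProd_two_mul, alternatingProd_two_mul, ← inv_mul_pow_of_involutive ha hb,
      eq_inv_iff_mul_eq_one, two_mul, pow_add]
  · rw [alternatingProd_two_mul_add_one, alternatingProd_two_mul_add_one,
      ← inv_mul_pow_of_involutive ha hb, eq_inv_mul_iff_mul_eq, two_mul, pow_succ, pow_add,
      ← mul_assoc (_ * _) a b, ← mul_assoc, mul_eq_one_iff_eq_inv,
      inv_eq_of_mul_eq_one_right hb]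

/-- The reflections met along the two sides of a braid relation are the same, in reverse order. -/
theorem alternatingProd_odd_reflect {a b : G} (ha : a * a = 1) (hb : b * b = 1) {m i : ℕ}
    (hi : i < m) (h : (a * b) ^ m = 1) :
    alternatingProd b a (2 * (m - 1 - i) + 1) = alternatingProd a b (2 * i + 1) := by
  rw [alternatingProd_two_mul_add_one, alternatingProd_two_mul_add_one,
    ← inv_mul_pow_of_involutive ha hb, inv_mul_eq_iff_eq_mul, ← mul_assoc, ← pow_add]
  have : (a * b) ^ (m - 1 - i + i) * (a * b) = 1 := by
    rw [← pow_succ, show m - 1 - i + i + 1 = m by omega, h]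
  rw [← mul_assoc] at this
  rw [eq_comm, mul_eq_one_iff_eq_inv.1 this, inv_eq_of_mul_eq_one_right hb]

end AlternatingProd

/-! ### Affine permutations from which the reflection cocycle is built. -/

section AffinePerm

variable {D : Type u} [Group D] {k : ℕ}

open Classical in
/-- The affine permutation `F ↦ (r ↦ F (x⁻¹ r x) + c [r = x])` of the functions `D → ℤ/k`. -/
def affinePerm (x : D) (c : ZMod k) : Equiv.Perm (D → ZMod k) where
  toFun F r := F (x⁻¹ * r * x) + if r = x then c else 0
  invFun F r := F (x * r * x⁻¹) - if r = x then c else 0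
  left_inv F := by
    funext r
    have : x * r * x⁻¹ = x ↔ r = x := by
      rw [mul_inv_eq_iff_eq_mul, mul_right_inj]
    simp only [this]
    simp [mul_assoc]
  right_inv F := by
    funext r
    have : x⁻¹ * r * x = x ↔ r = x := by
      rw [mul_assoc, inv_mul_eq_iff_eq_mul, mul_left_inj]
    simp only [this]
    simp [mul_assoc]

open Classical in
theorem affinePerm_apply (x : D) (c : ZMod k) (F : D → ZMod k) (r : D) :
    affinePerm x c F r = F (x⁻¹ * r * x) + if r = x then c else 0 := rfl

open Classical in
theorem affinePerm_pow_apply (x : D) (c : ZMod k) (n : ℕ) (F : D → ZMod k) (r : D) :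
    (affinePerm x c ^ n) F r = F ((x ^ n)⁻¹ * r * x ^ n) + if r = x then n * c else 0 := by
  induction n generalizing r with
  | zero => simp
  | succ n ih =>
    have : x⁻¹ * r * x = x ↔ r = x := by
      rw [mul_assoc, inv_mul_eq_iff_eq_mul, mul_left_inj]
    rw [pow_succ', Equiv.Perm.mul_apply, affinePerm_apply, ih, pow_succ', mul_inv_rev]
    simp only [this]
    simp only [mul_assoc]
    split_ifs <;> push_cast <;> ring

theorem affinePerm_comm {x y : D} (h : x * y = y * x) (c d : ZMod k) :
    affinePerm x c * affinePerm y d = affinePerm y d * affinePerm x c := by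
  classical
  ext F r
  have h1 : x⁻¹ * r * x = y ↔ r = y := by
    rw [mul_assoc, inv_mul_eq_iff_eq_mul, h, mul_left_inj]
  have h2 : y⁻¹ * r * y = x ↔ r = x := by
    rw [mul_assoc, inv_mul_eq_iff_eq_mul, ← h, mul_left_inj]
  have h3 : y⁻¹ * (x⁻¹ * r * x) * y = x⁻¹ * (y⁻¹ * r * y) * x := by
    have := congrArg (·⁻¹) h
    simp only [mul_inv_rev] at this
    simp only [← mul_assoc, this]
    simp only [mul_assoc, h]
  simp only [Equiv.Perm.mul_apply, affinePerm_apply, h1, h2, h3]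
  ring

-- The translation part collects one term for each reflection `(a b) ^ i a` met along the
-- alternating word.
open Classical in
theorem alternatingProd_affinePerm_apply {a b : D} (ha : a * a = 1) (hb : b * b = 1) (c : ZMod k)
    (j : ℕ) (F : D → ZMod k) (r : D) :
    alternatingProd (affinePerm a c) (affinePerm b c) j F r =
      F ((alternatingProd a b j)⁻¹ * r * alternatingProd a b j) +
        ∑ i ∈ Finset.range j, if r = alternatingProd a b (2 * i + 1) then c else 0 := by
  induction j generalizing a b r with
  | zero => simp
  | succ j ih =>
    have key : ∀ i, a⁻¹ * r * a = alternatingProd b a (2 * i + 1) ↔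
        r = alternatingProd a b (2 * (i + 1) + 1) := fun i => by
      rw [mul_assoc, inv_mul_eq_iff_eq_mul, show 2 * (i + 1) + 1 = (2 * i + 2) + 1 by ring,
        alternatingProd_succ a b, ← alternatingProd_two_mul_add_one_mul, ← mul_assoc,
        ← eq_mul_inv_iff_mul_eq, inv_eq_of_mul_eq_one_right ha]
    rw [alternatingProd_succ, Equiv.Perm.mul_apply, affinePerm_apply, ih hb ha,
      Finset.sum_range_succ', alternatingProd_succ, mul_inv_rev]
    simp only [key]
    simp only [mul_assoc, add_assoc]
    simp [alternatingProd]

/-- Both sides meet the same reflections, in opposite order, and each contributes the same constant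
`c`; so the translation parts agree. -/
theorem alternatingProd_affinePerm_eq {a b : D} (ha : a * a = 1) (hb : b * b = 1) (c : ZMod k)
    {m : ℕ} (h : alternatingProd a b m = alternatingProd b a m) :
    alternatingProd (affinePerm a c) (affinePerm b c) m =
      alternatingProd (affinePerm b c) (affinePerm a c) m := by
  classical
  ext F r
  rw [alternatingProd_affinePerm_apply ha hb, alternatingProd_affinePerm_apply hb ha, h,
    ← Finset.sum_range_reflect (fun i => if r = alternatingProd b a (2 * i + 1) then c else 0)]
  congr 1
  refine Finset.sum_congr rfl fun i hi => ?_
  rw [alternatingProd_odd_reflect ha hb (Finset.mem_range.1 hi)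
    ((alternatingProd_eq_iff ha hb m).1 h)]

end AffinePerm

/-! ### Labels, the universal property and the reflection cocycle. -/

namespace DyerGraph

variable {V : Type u} (Γ : DyerGraph V)

/-- The order of the generator `v`, with `0` for infinite order. -/
def order (v : V) : ℕ := (Γ.vertexWeight v).toNat

open Classical in
/-- The length of the relation between `u` and `v`: the edge weight, and `2` for non-adjacent
vertices. -/
def label (u v : V) : ℕ∞ := if h : Γ.graph.Adj u v then Γ.edgeWeight ⟨s(u, v), h⟩ else 2

variable {Γ}

theorem label_of_adj {u v : V} (h : Γ.graph.Adj u v) :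
    Γ.label u v = Γ.edgeWeight ⟨s(u, v), h⟩ := dif_pos h

theorem label_of_not_adj {u v : V} (h : ¬ Γ.graph.Adj u v) : Γ.label u v = 2 := dif_neg h

theorem label_comm (u v : V) : Γ.label u v = Γ.label v u := by
  by_cases h : Γ.graph.Adj u v
  · rw [label_of_adj h, label_of_adj h.symm]
    congr 2
    exact Sym2.eq_swap
  · rw [label_of_not_adj h, label_of_not_adj fun h' => h h'.symm]

theorem two_le_label (u v : V) : 2 ≤ Γ.label u v := by
  by_cases h : Γ.graph.Adj u v
  · rw [label_of_adj h]
    exact le_trans (by norm_num) (Γ.three_le_edgeWeight _)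
  · rw [label_of_not_adj h]

theorem order_eq_two_of_adj {u v : V} (h : Γ.graph.Adj u v) (hl : Γ.label u v ≠ ⊤) :
    Γ.order u = 2 := by
  have h2 := Γ.two_le_vertexWeight u
  by_cases h3 : 3 ≤ Γ.vertexWeight u
  · exact absurd (Γ.edgeWeight_eq_top ⟨s(u, v), h⟩ u (by simp) h3) (label_of_adj h ▸ hl)
  · unfold order
    cases hw : Γ.vertexWeight u with
    | top => simp [hw] at h3
    | coe k =>
      rw [hw] at h2 h3
      have h2' : 2 ≤ k := by exact_mod_cast h2
      have h3' : ¬ 3 ≤ k := by exact_mod_cast h3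
      simp only [ENat.toNat_natCast]
      omega

/-- The defining property of Dyer graphs in usable form: a finite relation is either a commutation
or a Coxeter relation between involutions. Later arguments about relations split along these two
cases. -/
theorem label_eq_two_or {u v : V} {k : ℕ} (hl : Γ.label u v = k) :
    k = 2 ∨ (Γ.order u = 2 ∧ Γ.order v = 2) := by
  by_cases h : Γ.graph.Adj u v
  · have ht : Γ.label u v ≠ ⊤ := by simp [hl]
    exact Or.inr ⟨order_eq_two_of_adj h ht, order_eq_two_of_adj h.symm (label_comm u v ▸ ht)⟩
  · rw [label_of_not_adj h] at hl
    exact Or.inl (by exact_mod_cast hl.symm)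

namespace IsAssociatedWith

variable {D : Type v} [Group D] {s : V → D}

theorem closure_range (h : Γ.IsAssociatedWith s) : Subgroup.closure (Set.range s) = ⊤ := by
  obtain ⟨e, he⟩ := h
  have hr : Set.range s = e.toMonoidHom '' Set.range (PresentedGroup.of (rels := Γ.relators)) := by
    rw [← Set.range_comp]
    exact congrArg Set.range (funext fun i => (he i).symm)
  rw [hr, ← MonoidHom.map_closure, PresentedGroup.closure_range_of]
  exact Subgroup.map_top_of_surjective _ e.surjective

theorem lift_relator (h : Γ.IsAssociatedWith s) {r : FreeGroup V} (hr : r ∈ Γ.relators) :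
    FreeGroup.lift s r = 1 := by
  obtain ⟨e, he⟩ := h
  have : FreeGroup.lift s = e.toMonoidHom.comp (PresentedGroup.mk Γ.relators) := by
    ext v
    rw [FreeGroup.lift_apply_of]
    exact (he v).symm
  rw [this]
  simp [PresentedGroup.one_of_mem hr]

theorem pow_order (h : Γ.IsAssociatedWith s) (v : V) : s v ^ Γ.order v = 1 := by
  unfold order
  cases hw : Γ.vertexWeight v with
  | top => simp
  | coe k => simpa using h.lift_relator (Or.inl (Or.inl ⟨v, k, hw, rfl⟩))

theorem alternatingProd_eq (h : Γ.IsAssociatedWith s) {u v : V} (huv : u ≠ v) {k : ℕ}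
    (hk : Γ.label u v = k) :
    alternatingProd (s u) (s v) k = alternatingProd (s v) (s u) k := by
  by_cases ha : Γ.graph.Adj u v
  · have := h.lift_relator (Or.inr ⟨u, v, ha, k, by rw [← hk, label_of_adj ha], rfl⟩)
    simpa [map_alternatingProd, mul_inv_eq_one] using this
  · rw [label_of_not_adj ha] at hk
    obtain rfl : 2 = k := by exact_mod_cast hk
    have := h.lift_relator (Or.inl (Or.inr ⟨u, v, huv, ha, rfl⟩))
    rw [map_mul, map_inv, map_alternatingProd, map_alternatingProd, mul_inv_eq_one] at this
    simpa using this

/-- The universal property of a Dyer group. -/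
theorem exists_lift (h : Γ.IsAssociatedWith s) {H : Type w} [Group H] (f : V → H)
    (hf : ∀ v, f v ^ Γ.order v = 1)
    (hlab : ∀ u v (k : ℕ), u ≠ v → Γ.label u v = k →
      alternatingProd (f u) (f v) k = alternatingProd (f v) (f u) k) :
    ∃ F : D →* H, ∀ v, F (s v) = f v := by
  obtain ⟨e, he⟩ := h
  have hrel : ∀ r ∈ Γ.relators, FreeGroup.lift f r = 1 := by
    rintro r ((⟨v, k, hv, rfl⟩ | ⟨u, v, huv, ha, rfl⟩) | ⟨u, v, ha, k, hk, rfl⟩)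
    · have := hf v
      rw [order, hv, ENat.toNat_natCast] at this
      simpa using this
    · rw [map_mul, map_inv, map_alternatingProd, map_alternatingProd, mul_inv_eq_one]
      simpa using hlab u v 2 huv (label_of_not_adj ha)
    · rw [map_mul, map_inv, map_alternatingProd, map_alternatingProd, mul_inv_eq_one]
      simpa using hlab u v k ha.ne ((label_of_adj ha).trans hk)
  refine ⟨(PresentedGroup.toGroup hrel).comp e.symm.toMonoidHom, fun v => ?_⟩
  rw [← he v]
  simp

theorem mul_self_of_order (h : Γ.IsAssociatedWith s) {v : V} (hv : Γ.order v = 2) :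
    s v * s v = 1 := by
  rw [← pow_two, ← hv, h.pow_order]

/-- The reflection cocycle with values in the functions `D → ℤ/k`, which counts the generators of
order `k`. -/
theorem exists_cocycle (h : Γ.IsAssociatedWith s) (k : ℕ) :
    ∃ N : D → D → ZMod k, (∀ g h r, N (g * h) r = N g r + N h (g⁻¹ * r * g)) ∧
      (∀ v, Γ.order v = k → N (s v) (s v) = 1) ∧
      ∀ v r, (Γ.order v ≠ k ∨ r ≠ s v) → N (s v) r = 0 := by
  classical
  -- Only generators of order `k` get a nonzero translation. For `k = 0` the coefficients are
  -- integers, which covers infinite order.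
  obtain ⟨Φ, hΦ⟩ := h.exists_lift
    (fun v => affinePerm (s v) (if Γ.order v = k then (1 : ZMod k) else 0)) (by
      intro v
      ext F r
      rw [affinePerm_pow_apply, h.pow_order]
      by_cases hk : Γ.order v = k
      · simp [hk]
      · simp [hk]) (by
      intro u v m huv hm
      rcases label_eq_two_or hm with rfl | ⟨hu, hv⟩
      · have := h.alternatingProd_eq huv hm
        simp only [alternatingProd, mul_one] at this ⊢
        exact affinePerm_comm this _ _
      · simp only [hu, hv]
        exact alternatingProd_affinePerm_eq (h.mul_self_of_order hu) (h.mul_self_of_order hv) _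
          (h.alternatingProd_eq huv hm))
  -- `Φ g` is affine with linear part conjugation by `g`, so its translation part `Φ g 0` is a
  -- cocycle.
  have key : ∀ g F r, Φ g F r = Φ g 0 r + F (g⁻¹ * r * g) := by
    intro g
    have hg : g ∈ Subgroup.closure (Set.range s) := h.closure_range ▸ Subgroup.mem_top g
    induction hg using Subgroup.closure_induction with
    | mem x hx =>
      obtain ⟨v, rfl⟩ := hx
      intro F r
      rw [hΦ, affinePerm_apply, affinePerm_apply, add_comm]
      simp
    | one => simp
    | mul x y _ _ hx hy =>
      intro F r
      rw [map_mul, Equiv.Perm.mul_apply, Equiv.Perm.mul_apply, hx, hx (Φ y 0), hy, mul_inv_rev]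
      simp only [mul_assoc, add_assoc]
    | inv x _ hx =>
      intro F r
      have h1 := hx ((Φ x)⁻¹ F) (x * r * x⁻¹)
      have h2 := hx ((Φ x)⁻¹ 0) (x * r * x⁻¹)
      have e : x⁻¹ * (x * r * x⁻¹) * x = r := by group
      rw [← Equiv.Perm.mul_apply, mul_inv_cancel, Equiv.Perm.one_apply, e] at h1 h2
      rw [map_inv, inv_inv, h1]
      rw [Pi.zero_apply] at h2
      linear_combination h2
  refine ⟨fun g => Φ g 0, fun g h r => ?_, fun v hv => ?_, fun v r hv => ?_⟩
  · simp only [map_mul, Equiv.Perm.mul_apply]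
    rw [key]
  · simp [hΦ, affinePerm_apply, hv]
  · simp only [hΦ, affinePerm_apply]
    rcases hv with hv | hv <;> simp [hv]

end IsAssociatedWith
end DyerGraph

end

noncomputable section

open Polynomial

/-! ### Generalized reflections and the relations between two of them. -/

section GeneralizedReflection

variable {V : Type u} {R : Type v} [CommRing R]

/-- The generalized reflections `x ↦ x - (1 - l) x_u B_u` of the module of functions `V → R`, where
`B_u` is a vector whose coordinate at `u` is `1`. They scale the coordinate at `u` by `l`. -/
def generalizedReflection (B : V → V → R) (hB : ∀ u, B u u = 1) (u : V) :
    Rˣ →* Equiv.Perm (V → R) where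
  toFun l :=
    { toFun := fun x w => x w - (1 - l) * x u * B u w
      invFun := fun x w => x w - (1 - ↑l⁻¹) * x u * B u w
      left_inv := fun x => by
        funext w
        simp only [hB]
        linear_combination (x u * B u w) * l.inv_mul
      right_inv := fun x => by
        funext w
        simp only [hB]
        linear_combination (x u * B u w) * l.inv_mul }
  map_one' := by ext; simp
  map_mul' l m := by
    ext x w
    simp only [Equiv.coe_fn_mk, Equiv.Perm.mul_apply, hB, Units.val_mul]
    ring

variable {B : V → V → R} {hB : ∀ u, B u u = 1}

theorem generalizedReflection_apply (u : V) (l : Rˣ) (x : V → R) (w : V) :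
    generalizedReflection B hB u l x w = x w - (1 - l) * x u * B u w := rfl

theorem generalizedReflection_comm {u v : V} (huv : B u v = 0) (hvu : B v u = 0) (l m : Rˣ) :
    generalizedReflection B hB u l * generalizedReflection B hB v m =
      generalizedReflection B hB v m * generalizedReflection B hB u l := by
  ext x w
  simp only [Equiv.Perm.mul_apply, generalizedReflection_apply, huv, hvu]
  ring

/-- The powers of a product of two reflections. -/
theorem generalizedReflection_mul_pow_apply {u v : V} {c : R} (huv : B u v = c) (hvu : B v u = c)
    {U : ℕ → R} (h0 : U 0 = 0) (h1 : U 1 = 1) (hU : ∀ j, U (j + 2) = 2 * c * U (j + 1) - U j)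
    (j : ℕ) (x : V → R) (w : V) :
    ((generalizedReflection B hB u (-1) * generalizedReflection B hB v (-1)) ^ j) x w =
      x w - 2 * U j * (x v * U j - x u * (2 * c * U j - U (j + 1))) * B v w -
        2 * U j * (x u * U j - x v * U (j + 1)) * B u w := by
  -- The quadratic invariant of the Chebyshev recurrence.
  have H : ∀ j, U (j + 1) ^ 2 - 2 * c * U j * U (j + 1) + U j ^ 2 = 1 := fun j => by
    induction j with
    | zero => simp [h0, h1]
    | succ j ih =>
      rw [hU]
      linear_combination ih
  induction j generalizing x with
  | zero => simp [h0]
  | succ j ih =>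
    rw [pow_succ, Equiv.Perm.mul_apply, ih, hU]
    simp only [Equiv.Perm.mul_apply, generalizedReflection_apply, huv, hvu, hB, Units.val_neg,
      Units.val_one]
    linear_combination (2 * x v * B v w + 2 * (x u - 2 * c * x v) * B u w) * H j

/-- The order of the product of two reflections. -/
theorem generalizedReflection_mul_pow_eq_one_iff [IsDomain R] [CharZero R] {u v : V} {c : R}
    (hne : u ≠ v) (huv : B u v = c) (hvu : B v u = c) (hc : c ^ 2 ≠ 1) {U : ℕ → R} (h0 : U 0 = 0)
    (h1 : U 1 = 1) (hU : ∀ j, U (j + 2) = 2 * c * U (j + 1) - U j) (j : ℕ) :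
    (generalizedReflection B hB u (-1) * generalizedReflection B hB v (-1)) ^ j = 1 ↔ U j = 0 := by
  classical
  constructor
  · intro h
    by_contra hj
    -- On the basis vector at `u`, the coordinate at `v` gives `U (j + 1) = c * U j`; the coordinate
    -- at `u` then gives `U j = c ^ 2 * U j`, against `c ^ 2 ≠ 1`.
    have key := fun w => congrFun (Equiv.congr_fun h (Pi.single u (1 : R))) w
    simp only [generalizedReflection_mul_pow_apply huv hvu h0 h1 hU, Equiv.Perm.one_apply] at key
    have ku := key u
    have kv := key v
    simp only [Pi.single_eq_same, Pi.single_eq_of_ne hne.symm, hB, huv, hvu] at ku kv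
    have h2 : (2 : R) * U j ≠ 0 := mul_ne_zero two_ne_zero hj
    have e1 : U (j + 1) = c * U j := by
      apply mul_left_cancel₀ h2
      linear_combination -kv
    have e2 : U j = c * (2 * c * U j - U (j + 1)) := by
      apply mul_left_cancel₀ h2
      linear_combination -ku
    apply hc
    apply mul_left_cancel₀ hj
    linear_combination c * e1 - e2
  · intro h
    ext x w
    simp [generalizedReflection_mul_pow_apply huv hvu h0 h1 hU, h]

end GeneralizedReflection

/-- Two generalized reflections with an indeterminate as their inner product satisfy no relation
between alternating products: the degrees of the coordinates grow. -/
theorem degree_alternatingProd_generalizedReflection {V : Type u} {K : Type v} [Field K]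
    {B : V → V → K[X]} {hB : ∀ u, B u u = 1} {u v : V} (huv : B u v = X) (hvu : B v u = X)
    {l m : Kˣ} (hl : l ≠ 1) (hm : m ≠ 1) (j : ℕ) :
    ∀ z, z = alternatingProd (generalizedReflection B hB u (Units.map (C : K →+* K[X]) l))
      (generalizedReflection B hB v (Units.map (C : K →+* K[X]) m)) j 1 →
    z v ≠ 0 ∧ (z u).degree ≤ (z v).degree ∧ (1 ≤ j → (z u).degree < (z v).degree) := by
  induction j generalizing u v l m with
  | zero =>
    rintro z rfl
    simp
  | succ j ih =>
    rintro z rfl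
    obtain ⟨h0, hle, -⟩ := ih hvu huv hm hl _ rfl
    rw [alternatingProd_succ, Equiv.Perm.mul_apply]
    set y := alternatingProd (generalizedReflection B hB v (Units.map (C : K →+* K[X]) m))
      (generalizedReflection B hB u (Units.map (C : K →+* K[X]) l)) j 1
    have hl' : (1 - (l : K)) ≠ 0 := sub_ne_zero.2 fun h => hl (Units.ext h.symm)
    have eu : generalizedReflection B hB u (Units.map (C : K →+* K[X]) l) y u = C (l : K) * y u := by
      rw [generalizedReflection_apply, hB]
      simp only [Units.coe_map, MonoidHom.coe_coe]
      ring
    have ev : generalizedReflection B hB u (Units.map (C : K →+* K[X]) l) y v =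
        y v - C (1 - (l : K)) * (y u * X) := by
      rw [generalizedReflection_apply, huv]
      simp only [Units.coe_map, MonoidHom.coe_coe, map_sub, map_one]
      ring
    have du : (C (l : K) * y u).degree = (y u).degree := degree_C_mul l.ne_zero
    have dx : (C (1 - (l : K)) * (y u * X)).degree = (y u).degree + 1 := by
      rw [degree_C_mul hl', degree_mul_X]
    have lt : (y u).degree < (y u).degree + 1 := by
      rw [degree_eq_natDegree h0]
      exact_mod_cast Nat.lt_succ_self _
    -- The coordinate at `u` dominated before this reflection, so its multiple by `X` decides the
    -- new degree at `v`.
    have dv : (y v - C (1 - (l : K)) * (y u * X)).degree = (y u).degree + 1 := by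
      rw [degree_sub_eq_right_of_degree_lt (by rw [dx]; exact hle.trans_lt lt), dx]
    rw [eu, ev, du, dv]
    refine ⟨fun h => ?_, lt.le, fun _ => lt⟩
    rw [h, degree_zero] at dv
    rw [← dv] at lt
    exact not_lt_bot lt

/-- Applied to the constant vector `1`, one product makes the coordinate at `v` the one of larger
degree, the other the coordinate at `u`. -/
theorem alternatingProd_generalizedReflection_ne {V : Type u} {K : Type v} [Field K]
    {B : V → V → K[X]} {hB : ∀ u, B u u = 1} {u v : V} (huv : B u v = X) (hvu : B v u = X)
    {l m : Kˣ} (hl : l ≠ 1) (hm : m ≠ 1) {j : ℕ} (hj : 1 ≤ j) :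
    alternatingProd (generalizedReflection B hB u (Units.map (C : K →+* K[X]) l))
      (generalizedReflection B hB v (Units.map (C : K →+* K[X]) m)) j ≠
    alternatingProd (generalizedReflection B hB v (Units.map (C : K →+* K[X]) m))
      (generalizedReflection B hB u (Units.map (C : K →+* K[X]) l)) j := by
  intro h
  have h1 := (degree_alternatingProd_generalizedReflection (hB := hB) huv hvu hl hm j _ rfl).2.2 hj
  have h2 := (degree_alternatingProd_generalizedReflection (hB := hB) hvu huv hm hl j _ rfl).2.2 hj
  rw [h] at h1
  exact lt_asymm h1 h2

/-! ### The generic reflection representation of a Dyer group. -/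

namespace DyerGraph

variable {V : Type u} {Γ : DyerGraph V}

theorem exists_isPrimitiveRoot_complex (n : ℕ) : ∃ z : ℂˣ, IsPrimitiveRoot z n := by
  rcases Nat.eq_zero_or_pos n with rfl | hn
  -- `IsPrimitiveRoot z 0` means that `z` has infinite order, as `2` has.
  · refine ⟨Units.mk0 2 two_ne_zero, by simp, fun l hl => ?_⟩
    have h2 : ((2 ^ l : ℕ) : ℂ) = 1 := by
      have := congrArg Units.val hl
      push_cast
      simpa using this
    have h3 : 2 ^ l = 1 := by exact_mod_cast h2
    have : l = 0 := by simpa using h3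
    simp [this]
  · have h := Complex.isPrimitiveRoot_exp n hn.ne'
    refine ⟨(h.isUnit hn.ne').unit, ?_⟩
    rw [← IsPrimitiveRoot.coe_units_iff]
    exact h

variable (Γ) in
/-- A complex number whose multiplicative order is that of the generator `v`. -/
def rootOfUnity (v : V) : ℂˣ := (exists_isPrimitiveRoot_complex (Γ.order v)).choose

theorem isPrimitiveRoot_rootOfUnity (v : V) : IsPrimitiveRoot (Γ.rootOfUnity v) (Γ.order v) :=
  (exists_isPrimitiveRoot_complex (Γ.order v)).choose_spec

theorem rootOfUnity_of_order {v : V} (h : Γ.order v = 2) : Γ.rootOfUnity v = -1 := by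
  have := isPrimitiveRoot_rootOfUnity (Γ := Γ) v
  rw [h, ← IsPrimitiveRoot.coe_units_iff] at this
  exact Units.ext (by simpa using this.eq_neg_one_of_two_right)

variable (Γ) in
open Classical in
/-- The matrix of the generic reflection representation. -/
def formMatrix (u v : V) : ℂ[X] :=
  if u = v then 1 else if Γ.label u v = ⊤ then X else
    C (Complex.cos (Real.pi / (Γ.label u v).toNat))

theorem formMatrix_self (u : V) : Γ.formMatrix u u = 1 := if_pos rfl

theorem formMatrix_of_top {u v : V} (huv : u ≠ v) (h : Γ.label u v = ⊤) :
    Γ.formMatrix u v = X := by simp [formMatrix, huv, h]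

theorem formMatrix_of_coe {u v : V} (huv : u ≠ v) {m : ℕ} (h : Γ.label u v = m) :
    Γ.formMatrix u v = C (Complex.cos (Real.pi / m)) := by simp [formMatrix, huv, h]

theorem formMatrix_of_two {u v : V} (huv : u ≠ v) (h : Γ.label u v = 2) :
    Γ.formMatrix u v = 0 := by
  have h' : Γ.label u v = (2 : ℕ) := h
  rw [formMatrix_of_coe huv h']
  simp [Complex.cos_pi_div_two]

variable (Γ) in
/-- The image of the generator `v` under the generic reflection representation. -/
def genericReflection (v : V) : Equiv.Perm (V → ℂ[X]) :=
  generalizedReflection Γ.formMatrix formMatrix_self v (Units.map (C : ℂ →+* ℂ[X]) (Γ.rootOfUnity v))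

theorem genericReflection_zpow (v : V) (a : ℤ) : Γ.genericReflection v ^ a =
    generalizedReflection Γ.formMatrix formMatrix_self v
      (Units.map (C : ℂ →+* ℂ[X]) (Γ.rootOfUnity v ^ a)) := by
  rw [genericReflection, map_zpow, map_zpow]

theorem genericReflection_pow_order (v : V) : Γ.genericReflection v ^ Γ.order v = 1 := by
  rw [genericReflection, ← map_pow, ← map_pow, (isPrimitiveRoot_rootOfUnity v).pow_eq_one,
    map_one, map_one]

theorem genericReflection_of_order {v : V} (h : Γ.order v = 2) : Γ.genericReflection v =
    generalizedReflection Γ.formMatrix formMatrix_self v (-1) := by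
  rw [genericReflection, rootOfUnity_of_order h]
  congr 1
  ext1
  simp

theorem genericReflection_mul_self {v : V} (h : Γ.order v = 2) :
    Γ.genericReflection v * Γ.genericReflection v = 1 := by
  rw [← pow_two, ← h, genericReflection_pow_order]

theorem sin_pi_div_ne_zero {m j : ℕ} (hj : 1 ≤ j) (hjm : j < m) :
    Complex.sin (j * (Real.pi / m)) ≠ 0 := by
  have hm : (0 : ℝ) < m := by exact_mod_cast (by omega : 0 < m)
  have hpos : 0 < Real.sin (j * (Real.pi / m)) := by
    apply Real.sin_pos_of_pos_of_lt_pi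
    · have : (0 : ℝ) < j := by exact_mod_cast hj
      have := Real.pi_pos
      positivity
    · have hlt : (j : ℝ) < m := by exact_mod_cast hjm
      rw [mul_div_assoc', div_lt_iff₀ hm, mul_comm]
      exact mul_lt_mul_of_pos_left hlt Real.pi_pos
  have := hpos.ne'
  exact_mod_cast this

theorem genericReflection_mul_pow_eq_one_iff {u v : V} (huv : u ≠ v) {m : ℕ}
    (h : Γ.label u v = m) (hu : Γ.order u = 2) (hv : Γ.order v = 2) {j : ℕ} (hj : j ≤ m) :
    (Γ.genericReflection u * Γ.genericReflection v) ^ j = 1 ↔ j = 0 ∨ j = m := by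
  have hm : 2 ≤ m := by
    have := two_le_label (Γ := Γ) u v
    rw [h] at this
    exact_mod_cast this
  have hs : Complex.sin (Real.pi / m) ≠ 0 := by
    simpa using sin_pi_div_ne_zero (m := m) le_rfl (by omega)
  have hm0 : (m : ℂ) ≠ 0 := by exact_mod_cast (by omega : m ≠ 0)
  -- With `θ = π / m`, the sequence `sin (j θ) / sin θ` solves the recurrence for `c = cos θ`.
  rw [genericReflection_of_order hu, genericReflection_of_order hv,
    generalizedReflection_mul_pow_eq_one_iff huv (formMatrix_of_coe huv h)
      (formMatrix_of_coe huv.symm ((label_comm v u).trans h))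
      (U := fun j => C (Complex.sin (j * (Real.pi / m)) / Complex.sin (Real.pi / m)))]
  · rw [map_eq_zero_iff _ C_injective, div_eq_zero_iff, or_iff_left hs]
    constructor
    · intro h0
      by_contra! hne
      exact sin_pi_div_ne_zero (Nat.one_le_iff_ne_zero.2 hne.1) (lt_of_le_of_ne hj hne.2) h0
    · rintro (rfl | rfl)
      · simp
      · rw [mul_div_cancel₀ _ hm0, Complex.sin_pi]
  · rw [← map_pow, ← C_1, C_injective.ne_iff]
    intro hc
    have := Complex.sin_sq_add_cos_sq (Real.pi / m)
    rw [hc, add_eq_right] at this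
    exact hs (by simpa using this)
  · simp
  · simp [hs]
  · intro i
    rw [← C_ofNat, ← C_mul, ← C_mul, ← C_sub]
    congr 1
    generalize (Real.pi : ℂ) / m = t at hs
    push_cast
    have e1 : ((i : ℂ) + 2) * t = (i + 1) * t + t := by ring
    have e2 : (i : ℂ) * t = (i + 1) * t - t := by ring
    rw [e1, e2, Complex.sin_add, Complex.sin_sub]
    field_simp
    ring

theorem alternatingProd_genericReflection_eq {u v : V} (huv : u ≠ v) {m : ℕ}
    (h : Γ.label u v = m) :
    alternatingProd (Γ.genericReflection u) (Γ.genericReflection v) m =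
      alternatingProd (Γ.genericReflection v) (Γ.genericReflection u) m := by
  rcases label_eq_two_or h with rfl | ⟨hu, hv⟩
  · simp only [alternatingProd, mul_one]
    exact generalizedReflection_comm (formMatrix_of_two huv h)
      (formMatrix_of_two huv.symm ((label_comm v u).trans h)) _ _
  · rw [alternatingProd_eq_iff (genericReflection_mul_self hu) (genericReflection_mul_self hv),
      genericReflection_mul_pow_eq_one_iff huv h hu hv le_rfl]
    exact Or.inr rfl

theorem rootOfUnity_zpow_ne_one {v : V} {a : ℤ} (ha : ¬ (Γ.order v : ℤ) ∣ a) :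
    Γ.rootOfUnity v ^ a ≠ 1 := fun h =>
  ha (((isPrimitiveRoot_rootOfUnity v).zpow_eq_one_iff_dvd a).1 h)

theorem zpow_of_mul_self {G : Type v} [Group G] {x : G} (hx : x * x = 1) {a : ℤ}
    (ha : ¬ (2 : ℤ) ∣ a) : x ^ a = x := by
  obtain ⟨b, rfl⟩ : Odd a := by rwa [← Int.not_even_iff_odd, even_iff_two_dvd]
  rw [zpow_add, zpow_mul, zpow_one, zpow_ofNat, pow_two, hx, one_zpow, one_mul]

/-- The basis vector at `u` separates them: the left side scales its coordinate at `u` by a number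
other than `1`, and the right side fixes it. -/
theorem genericReflection_zpow_ne {u v : V} (huv : u ≠ v) {a b : ℤ}
    (ha : ¬ (Γ.order u : ℤ) ∣ a) :
    Γ.genericReflection u ^ a ≠ Γ.genericReflection v ^ b := by
  intro h
  classical
  have h1 := congrFun (Equiv.congr_fun h (Pi.single u (1 : ℂ[X]))) u
  rw [genericReflection_zpow, genericReflection_zpow, generalizedReflection_apply,
    generalizedReflection_apply, formMatrix_self, Pi.single_eq_same,
    Pi.single_eq_of_ne huv.symm] at h1
  apply rootOfUnity_zpow_ne_one ha
  have h2 : (C ((Γ.rootOfUnity u ^ a : ℂˣ) : ℂ) : ℂ[X]) = C 1 := by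
    simp only [Units.coe_map, MonoidHom.coe_coe] at h1
    rw [C_1]
    linear_combination h1
  exact Units.ext (C_injective h2)

/-- For an infinite label the degrees decide; for label `2` only `j = 1` remains; otherwise both
generators are involutions and the order of their product is the label. -/
theorem alternatingProd_genericReflection_ne {u v : V} (huv : u ≠ v) {a b : ℤ}
    (ha : ¬ (Γ.order u : ℤ) ∣ a) (hb : ¬ (Γ.order v : ℤ) ∣ b) {j : ℕ} (hj : 1 ≤ j)
    (hjm : (j : ℕ∞) < Γ.label u v) :
    alternatingProd (Γ.genericReflection u ^ a) (Γ.genericReflection v ^ b) j ≠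
      alternatingProd (Γ.genericReflection v ^ b) (Γ.genericReflection u ^ a) j := by
  cases hl : Γ.label u v with
  | top =>
    rw [genericReflection_zpow, genericReflection_zpow]
    exact alternatingProd_generalizedReflection_ne (formMatrix_of_top huv hl)
      (formMatrix_of_top huv.symm ((label_comm v u).trans hl)) (rootOfUnity_zpow_ne_one ha)
      (rootOfUnity_zpow_ne_one hb) hj
  | coe m =>
    have hjm' : j < m := by rw [hl] at hjm; exact_mod_cast hjm
    rcases label_eq_two_or hl with rfl | ⟨hu, hv⟩
    · obtain rfl : j = 1 := by omega
      simpa [alternatingProd] using genericReflection_zpow_ne huv ha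
    · rw [hu] at ha
      rw [hv] at hb
      rw [zpow_of_mul_self (genericReflection_mul_self hu) (by exact_mod_cast ha),
        zpow_of_mul_self (genericReflection_mul_self hv) (by exact_mod_cast hb), Ne,
        alternatingProd_eq_iff (genericReflection_mul_self hu) (genericReflection_mul_self hv),
        genericReflection_mul_pow_eq_one_iff huv hl hu hv hjm'.le]
      omega

namespace IsAssociatedWith

variable {D : Type v} [Group D] {s : V → D}

/-- Below the length of the defining relation, the alternating products of two syllables differ. -/
theorem alternatingProd_ne (h : Γ.IsAssociatedWith s) {u v : V} (huv : u ≠ v) {a b : ℤ}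
    (ha : ¬ (Γ.order u : ℤ) ∣ a) (hb : ¬ (Γ.order v : ℤ) ∣ b) {j : ℕ} (hj : 1 ≤ j)
    (hjm : (j : ℕ∞) < Γ.label u v) :
    alternatingProd (s u ^ a) (s v ^ b) j ≠ alternatingProd (s v ^ b) (s u ^ a) j := by
  obtain ⟨F, hF⟩ := h.exists_lift Γ.genericReflection genericReflection_pow_order
    fun u v k huv => alternatingProd_genericReflection_eq huv
  intro he
  have := congrArg F he
  rw [map_alternatingProd, map_alternatingProd, map_zpow, map_zpow, hF, hF] at this
  exact alternatingProd_genericReflection_ne huv ha hb hj hjm this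

/-- The relation passes to syllables: powers of commuting elements commute, and an odd power of an
involution is the involution itself. -/
theorem alternatingProd_zpow_eq (h : Γ.IsAssociatedWith s) {u v : V} (huv : u ≠ v) {a b : ℤ}
    (ha : ¬ (Γ.order u : ℤ) ∣ a) (hb : ¬ (Γ.order v : ℤ) ∣ b) {k : ℕ} (hk : Γ.label u v = k) :
    alternatingProd (s u ^ a) (s v ^ b) k = alternatingProd (s v ^ b) (s u ^ a) k := by
  have := h.alternatingProd_eq huv hk
  rcases label_eq_two_or hk with rfl | ⟨hu, hv⟩
  · simp only [alternatingProd, mul_one] at this ⊢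
    exact (Commute.zpow_zpow this a b)
  · rw [hu] at ha
    rw [hv] at hb
    rwa [zpow_of_mul_self (h.mul_self_of_order hu) (by exact_mod_cast ha),
      zpow_of_mul_self (h.mul_self_of_order hv) (by exact_mod_cast hb)]

end IsAssociatedWith
end DyerGraph

end

noncomputable section

/-! ### Syllables: balanced residues as exponents. -/

namespace DyerGraph

variable {V : Type u} (Γ : DyerGraph V)

/-- A syllable: a non-zero exponent in the balanced range of residues modulo the order of the
generator. -/
def IsSyllable (x : V × ℤ) : Prop :=
  x.2 ≠ 0 ∧ (Γ.order x.1 ≠ 0 → -(Γ.order x.1 : ℤ) ≤ 2 * x.2 ∧ 2 * x.2 < Γ.order x.1)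

variable {Γ}

theorem IsSyllable.not_dvd {x : V × ℤ} (h : Γ.IsSyllable x) : ¬ (Γ.order x.1 : ℤ) ∣ x.2 := by
  rintro ⟨t, ht⟩
  obtain ⟨h0, h1⟩ := h
  by_cases ho : Γ.order x.1 = 0
  · rw [ho] at ht
    simp at ht
    exact h0 ht
  · obtain ⟨h2, h3⟩ := h1 ho
    have hpos : (0 : ℤ) < Γ.order x.1 := by exact_mod_cast Nat.pos_of_ne_zero ho
    generalize (Γ.order x.1 : ℤ) = n at *
    rw [ht] at h2 h3 h0
    have : t < 1 := by nlinarith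
    have : -1 < t := by nlinarith
    have : t = 0 := by omega
    simp [this] at h0

theorem IsSyllable.cast_ne_zero {x : V × ℤ} (h : Γ.IsSyllable x) :
    (x.2 : ZMod (Γ.order x.1)) ≠ 0 := fun h' =>
  h.not_dvd ((CharP.intCast_eq_zero_iff (ZMod (Γ.order x.1)) (Γ.order x.1) x.2).1 h')

theorem IsSyllable.eq_of_cast_eq {x y : V × ℤ} (hx : Γ.IsSyllable x) (hy : Γ.IsSyllable y)
    (ho : Γ.order x.1 = Γ.order y.1) (h : (x.2 : ZMod (Γ.order x.1)) = y.2) : x.2 = y.2 := by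
  rw [ZMod.intCast_eq_intCast_iff_dvd_sub] at h
  obtain ⟨t, ht⟩ := h
  by_cases h0 : Γ.order x.1 = 0
  · rw [h0] at ht
    simp at ht
    omega
  · obtain ⟨h1, h2⟩ := hx.2 h0
    obtain ⟨h3, h4⟩ := hy.2 (ho ▸ h0)
    rw [← ho] at h3 h4
    have hpos : (0 : ℤ) < Γ.order x.1 := by exact_mod_cast Nat.pos_of_ne_zero h0
    generalize (Γ.order x.1 : ℤ) = n at *
    have : t < 1 := by nlinarith
    have : -1 < t := by nlinarith
    have : t = 0 := by omega
    simp [this] at ht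
    omega

/-- The balanced range is half-open and keeps the negative end, so an involution has only this
exponent. -/
theorem IsSyllable.eq_neg_one {x : V × ℤ} (hx : Γ.IsSyllable x) (h : Γ.order x.1 = 2) :
    x.2 = -1 := by
  obtain ⟨h0, h1⟩ := hx
  rw [h] at h1
  have := h1 (by norm_num)
  push_cast at this
  omega

/-- Every exponent that is not trivial modulo the order is congruent to that of a syllable, which
is not larger in absolute value. -/
theorem exists_isSyllable (v : V) {a : ℤ} (ha : ¬ (Γ.order v : ℤ) ∣ a) :
    ∃ b : ℤ, Γ.IsSyllable (v, b) ∧ (Γ.order v : ℤ) ∣ a - b ∧ b.natAbs ≤ a.natAbs := by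
  by_cases h0 : Γ.order v = 0
  · refine ⟨a, ⟨?_, fun h => absurd h0 h⟩, by simp, le_rfl⟩
    rintro rfl
    simp at ha
  · have hpos : 0 < Γ.order v := Nat.pos_of_ne_zero h0
    have hdvd : (Γ.order v : ℤ) ∣ a - a.bmod (Γ.order v) := Int.dvd_self_sub_bmod
    have hle := Int.le_bmod (x := a) hpos
    have hlt := Int.bmod_lt (x := a) hpos
    refine ⟨a.bmod (Γ.order v), ⟨?_, fun _ => ⟨?_, ?_⟩⟩, hdvd, ?_⟩
    · intro h
      simp only at h
      rw [h, sub_zero] at hdvd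
      exact ha hdvd
    · simp only
      omega
    · simp only
      omega
    · obtain ⟨t, ht⟩ := hdvd
      generalize a.bmod (Γ.order v) = b at *
      rcases lt_trichotomy t 0 with h | rfl | h
      · have : (Γ.order v : ℤ) * t ≤ -(Γ.order v : ℤ) := by nlinarith
        omega
      · simp at ht
        omega
      · have : (Γ.order v : ℤ) ≤ (Γ.order v : ℤ) * t := by nlinarith
        omega

end DyerGraph

/-! ### Words in syllables -/

section Words

variable {V : Type u} {D : Type v} [Group D]

/-- The element represented by a word in syllables. -/
def wordProd (s : V → D) (w : List (V × ℤ)) : D := (w.map fun x => s x.1 ^ x.2).prod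

/-- `w` is a shortest word in syllables for the element it represents. -/
def IsShortest (s : V → D) (w : List (V × ℤ)) : Prop :=
  ∀ w', wordProd s w' = wordProd s w → w.length ≤ w'.length

/-- `r` is one of the reflections that are attached to the syllables of the word `w`. -/
def IsReflectionOf (s : V → D) (r : D) (w : List (V × ℤ)) : Prop :=
  ∃ w₁ x w₂, w = w₁ ++ x :: w₂ ∧ r = wordProd s w₁ * s x.1 * (wordProd s w₁)⁻¹

/-- The sum of the absolute values of the exponents. -/
def wordWeight (w : List (V × ℤ)) : ℕ := (w.map fun x => x.2.natAbs).sum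

/-- The alternating list `[x, y, x, …]` of length `k`. -/
def alternatingList {α : Type u} (x y : α) : ℕ → List α
  | 0 => []
  | k + 1 => x :: alternatingList y x k

variable {s : V → D}

@[simp] theorem wordProd_nil : wordProd s [] = 1 := rfl

@[simp] theorem wordProd_cons (x : V × ℤ) (w : List (V × ℤ)) :
    wordProd s (x :: w) = s x.1 ^ x.2 * wordProd s w := by simp [wordProd]

@[simp] theorem wordProd_append (w₁ w₂ : List (V × ℤ)) :
    wordProd s (w₁ ++ w₂) = wordProd s w₁ * wordProd s w₂ := by simp [wordProd]

@[simp] theorem wordWeight_nil : wordWeight ([] : List (V × ℤ)) = 0 := rfl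

@[simp] theorem wordWeight_cons (x : V × ℤ) (w : List (V × ℤ)) :
    wordWeight (x :: w) = x.2.natAbs + wordWeight w := by simp [wordWeight]

@[simp] theorem wordWeight_append (w₁ w₂ : List (V × ℤ)) :
    wordWeight (w₁ ++ w₂) = wordWeight w₁ + wordWeight w₂ := by simp [wordWeight]

theorem alternatingList_succ {α : Type u} (x y : α) (k : ℕ) :
    alternatingList x y (k + 1) = x :: alternatingList y x k := rfl

@[simp] theorem length_alternatingList {α : Type u} (x y : α) (k : ℕ) :
    (alternatingList x y k).length = k := by
  induction k generalizing x y with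
  | zero => rfl
  | succ k ih => simp [alternatingList_succ, ih]

theorem map_alternatingList {α : Type u} {β : Type v} (f : α → β) (x y : α) (k : ℕ) :
    (alternatingList x y k).map f = alternatingList (f x) (f y) k := by
  induction k generalizing x y with
  | zero => rfl
  | succ k ih => simp [alternatingList_succ, ih]

theorem mem_alternatingList {α : Type u} {x y z : α} {k : ℕ} (h : z ∈ alternatingList x y k) :
    z = x ∨ z = y := by
  induction k generalizing x y with
  | zero => simp [alternatingList] at h
  | succ k ih =>
    rcases List.mem_cons.1 h with h | h
    · exact Or.inl h
    · exact (ih h).symm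

theorem mem_alternatingList_iff {α : Type u} {x y z : α} {k : ℕ} (hk : 2 ≤ k) :
    z ∈ alternatingList x y k ↔ z = x ∨ z = y := by
  obtain ⟨k, rfl⟩ := Nat.exists_eq_add_of_le' hk
  refine ⟨mem_alternatingList, ?_⟩
  rintro (rfl | rfl) <;> simp [alternatingList]

theorem alternatingList_eq_append_cons {α : Type u} {x y z : α} {k : ℕ} {p q : List α}
    (h : alternatingList x y k = p ++ z :: q) :
    ∃ i < k, p = alternatingList x y i ∧ p ++ [z] = alternatingList x y (i + 1) := by
  induction k generalizing x y p with
  | zero => simp [alternatingList] at h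
  | succ k ih =>
    cases p with
    | nil =>
      simp only [alternatingList_succ, List.nil_append, List.cons.injEq] at h
      exact ⟨0, by omega, rfl, by simp [alternatingList, h.1]⟩
    | cons y' p =>
      simp only [alternatingList_succ, List.cons_append, List.cons.injEq] at h
      obtain ⟨i, hi, h1, h2⟩ := ih h.2
      refine ⟨i + 1, by omega, ?_, ?_⟩
      · rw [alternatingList_succ, ← h1, h.1]
      · rw [alternatingList_succ, ← h2, h.1, List.cons_append]

theorem alternatingList_prefix {α : Type u} (x y : α) {j k : ℕ} (h : j ≤ k) :
    ∃ l, alternatingList x y k = alternatingList x y j ++ l := by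
  induction j generalizing x y k with
  | zero => exact ⟨_, rfl⟩
  | succ j ih =>
    obtain ⟨k, rfl⟩ := Nat.exists_eq_add_of_le' (Nat.one_le_iff_ne_zero.2 (by omega : k ≠ 0))
    obtain ⟨l, hl⟩ := ih y x (by omega : j ≤ k)
    exact ⟨l, by rw [alternatingList_succ, alternatingList_succ, hl, List.cons_append]⟩

theorem wordProd_alternatingList (x y : V × ℤ) (k : ℕ) :
    wordProd s (alternatingList x y k) = alternatingProd (s x.1 ^ x.2) (s y.1 ^ y.2) k := by
  induction k generalizing x y with
  | zero => rfl
  | succ k ih => rw [alternatingList_succ, wordProd_cons, ih, alternatingProd_succ]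

theorem wordWeight_alternatingList {x y : V × ℤ} (h : x.2 = y.2) (k : ℕ) :
    wordWeight (alternatingList x y k) = k * x.2.natAbs := by
  induction k generalizing x y with
  | zero => simp [alternatingList]
  | succ k ih => rw [alternatingList_succ, wordWeight_cons, ih h.symm, h]; ring

theorem IsShortest.of_infix {w₁ w w₂ : List (V × ℤ)} (h : IsShortest s (w₁ ++ w ++ w₂)) :
    IsShortest s w := by
  intro w' hw'
  have := h (w₁ ++ w' ++ w₂) (by simp [hw'])
  simpa using this

theorem IsShortest.tail {x : V × ℤ} {w : List (V × ℤ)} (h : IsShortest s (x :: w)) :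
    IsShortest s w := IsShortest.of_infix (w₁ := [x]) (w₂ := []) (by simpa using h)

theorem IsShortest.congr {w w' : List (V × ℤ)} (h : IsShortest s w)
    (hp : wordProd s w' = wordProd s w) (hl : w'.length = w.length) : IsShortest s w' :=
  fun w'' hw'' => hl ▸ h w'' (hw''.trans hp)

theorem exists_isShortest (s : V → D) (w : List (V × ℤ)) :
    ∃ w', wordProd s w' = wordProd s w ∧ IsShortest s w' := by
  obtain ⟨w', hw', hmin⟩ := (measure (List.length (α := V × ℤ))).wf.has_min
    {w' | wordProd s w' = wordProd s w} ⟨w, rfl⟩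
  exact ⟨w', hw', fun w'' h => not_lt.1 (hmin w'' (h.trans hw'))⟩

/-- The exchange condition: a syllable can be moved to the front as a power of its reflection. -/
theorem wordProd_exchange {r : D} {w₁ w₂ : List (V × ℤ)} {x : V × ℤ}
    (hr : r = wordProd s w₁ * s x.1 * (wordProd s w₁)⁻¹) :
    wordProd s (w₁ ++ x :: w₂) = r ^ x.2 * wordProd s (w₁ ++ w₂) := by
  rw [hr, conj_zpow]
  simp [mul_assoc]

/-- If an earlier syllable had the same reflection, the syllable `x` could be moved next to it and
merged with it, which saves a letter. -/
theorem not_isReflectionOf_left {w₁ w₂ : List (V × ℤ)} {x : V × ℤ}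
    (h : IsShortest s (w₁ ++ x :: w₂)) :
    ¬ IsReflectionOf s (wordProd s w₁ * s x.1 * (wordProd s w₁)⁻¹) w₁ := by
  rintro ⟨p, y, q, hw, hr⟩
  have h1 := wordProd_exchange (w₂ := w₂) (rfl :
    wordProd s w₁ * s x.1 * (wordProd s w₁)⁻¹ = wordProd s w₁ * s x.1 * (wordProd s w₁)⁻¹)
  rw [hr, conj_zpow] at h1
  have := h (p ++ (y.1, x.2 + y.2) :: (q ++ w₂)) (by
    rw [h1, hw]
    simp [mul_assoc, zpow_add])
  rw [hw] at this
  simp at this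

/-- A later syllable with this reflection could be moved forward and merged into `x`. -/
theorem not_isReflectionOf_right {w₁ w₂ : List (V × ℤ)} {x : V × ℤ}
    (h : IsShortest s (w₁ ++ x :: w₂)) : ¬ IsReflectionOf s (s x.1) w₂ := by
  rintro ⟨p, y, q, hw, hr⟩
  have := h (w₁ ++ (x.1, x.2 + y.2) :: (p ++ q)) (by
    rw [hw, wordProd_append, wordProd_append, wordProd_cons, wordProd_cons, wordProd_exchange hr]
    simp [mul_assoc, zpow_add])
  rw [hw] at this
  simp at this

end Words

/-! ### Minimal words and elementary moves. -/

namespace DyerGraph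

variable {V : Type u} {Γ : DyerGraph V}

variable (Γ) in
/-- A shortest word all of whose letters are syllables. -/
def IsMinimal {D : Type v} [Group D] (s : V → D) (w : List (V × ℤ)) : Prop :=
  (∀ x ∈ w, Γ.IsSyllable x) ∧ IsShortest s w

variable (Γ) in
/-- The elementary moves: replace `[x, y]_k` by `[y, x]_k`, where `k` is the label. -/
def BraidStep (w w' : List (V × ℤ)) : Prop :=
  ∃ (w₁ w₂ : List (V × ℤ)) (x y : V × ℤ) (k : ℕ), x.1 ≠ y.1 ∧ Γ.label x.1 y.1 = k ∧
    w = w₁ ++ alternatingList x y k ++ w₂ ∧ w' = w₁ ++ alternatingList y x k ++ w₂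

theorem BraidStep.cons {w w' : List (V × ℤ)} (h : Γ.BraidStep w w') (x : V × ℤ) :
    Γ.BraidStep (x :: w) (x :: w') := by
  obtain ⟨w₁, w₂, y, z, k, hne, hk, rfl, rfl⟩ := h
  exact ⟨x :: w₁, w₂, y, z, k, hne, hk, by simp, by simp⟩

theorem BraidStep.isSyllable {w w' : List (V × ℤ)} (h : Γ.BraidStep w w')
    (hw : ∀ x ∈ w, Γ.IsSyllable x) : ∀ x ∈ w', Γ.IsSyllable x := by
  obtain ⟨w₁, w₂, x, y, k, hne, hk, rfl, rfl⟩ := h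
  have h2 : 2 ≤ k := by
    have := two_le_label (Γ := Γ) x.1 y.1
    rw [hk] at this
    exact_mod_cast this
  intro z hz
  apply hw
  simp only [List.mem_append, mem_alternatingList_iff h2] at hz ⊢
  tauto

/-- A move of length `2` only permutes two syllables; in the other moves all exponents are `-1`, so
the weight depends only on the number of letters. -/
theorem BraidStep.wordWeight_eq {w w' : List (V × ℤ)} (h : Γ.BraidStep w w')
    (hw : ∀ x ∈ w, Γ.IsSyllable x) : wordWeight w = wordWeight w' := by
  obtain ⟨w₁, w₂, x, y, k, hne, hk, rfl, rfl⟩ := h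
  simp only [wordWeight_append]
  congr 2
  rcases label_eq_two_or hk with rfl | ⟨hx, hy⟩
  · simp [alternatingList, add_comm]
  · have h2 : 2 ≤ k := by
      have := two_le_label (Γ := Γ) x.1 y.1
      rw [hk] at this
      exact_mod_cast this
    have ex := (hw x (by simp [mem_alternatingList_iff h2])).eq_neg_one hx
    have ey := (hw y (by simp [mem_alternatingList_iff h2])).eq_neg_one hy
    rw [wordWeight_alternatingList (ex.trans ey.symm), wordWeight_alternatingList
      (ey.trans ex.symm), ex, ey]

theorem wordWeight_eq_of_reflTransGen {w w' : List (V × ℤ)}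
    (h : Relation.ReflTransGen Γ.BraidStep w w') (hw : ∀ x ∈ w, Γ.IsSyllable x) :
    wordWeight w = wordWeight w' := by
  induction h using Relation.ReflTransGen.head_induction_on with
  | refl => rfl
  | head h _ ih => rw [h.wordWeight_eq hw, ih (h.isSyllable hw)]

end DyerGraph

end

noncomputable section

/-! ### Exchange condition and connectedness of minimal words. -/

namespace DyerGraph
namespace IsAssociatedWith

variable {V : Type u} {Γ : DyerGraph V} {D : Type v} [Group D] {s : V → D}

/-- A choice of the reflection cocycle with values in the functions `D → ℤ/k`. -/
def cocycle (h : Γ.IsAssociatedWith s) (k : ℕ) : D → D → ZMod k := (h.exists_cocycle k).choose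

theorem cocycle_mul (h : Γ.IsAssociatedWith s) (k : ℕ) (g g' r : D) :
    h.cocycle k (g * g') r = h.cocycle k g r + h.cocycle k g' (g⁻¹ * r * g) :=
  (h.exists_cocycle k).choose_spec.1 g g' r

theorem cocycle_one (h : Γ.IsAssociatedWith s) (k : ℕ) (r : D) : h.cocycle k 1 r = 0 := by
  have := h.cocycle_mul k 1 1 r
  simpa using this

open Classical in
theorem cocycle_zpow (h : Γ.IsAssociatedWith s) (k : ℕ) (v : V) (a : ℤ) (r : D) :
    h.cocycle k (s v ^ a) r = if Γ.order v = k ∧ r = s v then (a : ZMod k) else 0 := by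
  have h1 : ∀ r, h.cocycle k (s v) r = if Γ.order v = k ∧ r = s v then 1 else 0 := fun r => by
    split_ifs with hr
    · rw [hr.2]
      exact (h.exists_cocycle k).choose_spec.2.1 v hr.1
    · exact (h.exists_cocycle k).choose_spec.2.2 v r (by tauto)
  have hc : ∀ r, (s v)⁻¹ * r * s v = s v ↔ r = s v := fun r => by
    rw [mul_assoc, inv_mul_eq_iff_eq_mul, mul_left_inj]
  have step : ∀ (a : ℤ) r, h.cocycle k (s v ^ (a + 1)) r =
      h.cocycle k (s v) r + h.cocycle k (s v ^ a) ((s v)⁻¹ * r * s v) := fun a r => by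
    rw [add_comm a 1, zpow_add, zpow_one, cocycle_mul]
  induction a generalizing r with
  | zero => simp [cocycle_one]
  | succ a ih =>
    rw [step, ih, h1]
    simp only [hc]
    split_ifs <;> push_cast <;> ring
  | pred a ih =>
    have h2 := step (-(a : ℤ) - 1) (s v * r * (s v)⁻¹)
    have h3 : (s v)⁻¹ * (s v * r * (s v)⁻¹) * s v = r := by group
    have h4 : s v * r * (s v)⁻¹ = s v ↔ r = s v := by
      rw [mul_inv_eq_iff_eq_mul, mul_right_inj]
    rw [sub_add_cancel, ih, h1, h3] at h2
    simp only [h4] at h2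
    rw [← sub_eq_iff_eq_add'] at h2
    rw [← h2]
    split_ifs <;> push_cast <;> ring

/-- By the cocycle rule, each syllable contributes only at its own reflection. -/
theorem cocycle_eq_zero (h : Γ.IsAssociatedWith s) (k : ℕ) {w : List (V × ℤ)} {r : D}
    (hr : ¬ IsReflectionOf s r w) : h.cocycle k (wordProd s w) r = 0 := by
  induction w generalizing r with
  | nil => exact h.cocycle_one k r
  | cons x w ih =>
    rw [wordProd_cons, cocycle_mul, cocycle_zpow, if_neg, zero_add, ih]
    · rintro ⟨p, y, q, hw, hy⟩
      refine hr ⟨x :: p, y, q, by rw [hw, List.cons_append], ?_⟩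
      have : r = s x.1 ^ x.2 * ((s x.1 ^ x.2)⁻¹ * r * s x.1 ^ x.2) * (s x.1 ^ x.2)⁻¹ := by group
      rw [this, hy, wordProd_cons]
      simp only [mul_inv_rev, mul_assoc]
    · rintro ⟨-, hx⟩
      exact hr ⟨[], x, w, rfl, by simpa using hx⟩

-- In a shortest word the reflection of `x` belongs to no other syllable, so only `x` contributes.
open Classical in
theorem cocycle_reflection (h : Γ.IsAssociatedWith s) (k : ℕ) {w₁ w₂ : List (V × ℤ)} {x : V × ℤ}
    (hw : IsShortest s (w₁ ++ x :: w₂)) {r : D}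
    (hr : r = wordProd s w₁ * s x.1 * (wordProd s w₁)⁻¹) :
    h.cocycle k (wordProd s (w₁ ++ x :: w₂)) r =
      if Γ.order x.1 = k then (x.2 : ZMod k) else 0 := by
  have e1 : (wordProd s w₁)⁻¹ * r * wordProd s w₁ = s x.1 := by rw [hr]; group
  have e2 : (s x.1 ^ x.2)⁻¹ * s x.1 * s x.1 ^ x.2 = s x.1 := by group
  rw [wordProd_append, cocycle_mul, h.cocycle_eq_zero k (hr ▸ not_isReflectionOf_left hw), e1,
    wordProd_cons, cocycle_mul, e2, h.cocycle_eq_zero k (not_isReflectionOf_right hw),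
    cocycle_zpow]
  simp

/-- The syllable that belongs to the reflection `s v` has the same order and exponent in all
minimal words of an element. -/
theorem exists_split (h : Γ.IsAssociatedWith s) {x : V × ℤ} {u w : List (V × ℤ)}
    (hx : Γ.IsSyllable x) (hu : IsShortest s (x :: u)) (hw : Γ.IsMinimal s w)
    (he : wordProd s w = wordProd s (x :: u)) :
    ∃ w₁ v w₂, w = w₁ ++ (v, x.2) :: w₂ ∧ s x.1 = wordProd s w₁ * s v * (wordProd s w₁)⁻¹ := by
  have hN := fun k => h.cocycle_reflection k (w₁ := []) (r := s x.1) hu (by simp)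
  simp only [List.nil_append] at hN
  have hr : IsReflectionOf s (s x.1) w := by
    by_contra hr
    have := h.cocycle_eq_zero (Γ.order x.1) hr
    rw [he, hN, if_pos rfl] at this
    exact hx.cast_ne_zero this
  obtain ⟨w₁, y, w₂, rfl, hy⟩ := hr
  have hN' := fun k => h.cocycle_reflection k hw.2 hy
  rw [he] at hN'
  have key := (hN (Γ.order x.1)).symm.trans (hN' (Γ.order x.1))
  rw [if_pos rfl] at key
  have ho : Γ.order y.1 = Γ.order x.1 := by
    by_contra hne
    rw [if_neg hne] at key
    exact hx.cast_ne_zero key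
  rw [if_pos ho] at key
  have := hx.eq_of_cast_eq (hw.1 y (by simp)) ho.symm key
  exact ⟨w₁, y.1, w₂, by rw [this], hy⟩

theorem zpow_eq_zpow (h : Γ.IsAssociatedWith s) {v : V} {a b : ℤ}
    (hab : (Γ.order v : ℤ) ∣ a - b) : s v ^ a = s v ^ b := by
  obtain ⟨t, ht⟩ := hab
  rw [show a = b + Γ.order v * t by omega, zpow_add, zpow_mul, zpow_natCast, h.pow_order,
    one_zpow, mul_one]

/-- A syllable can be put in front of a minimal word, unless its generator is a reflection of
this word. -/
theorem isMinimal_cons (h : Γ.IsAssociatedWith s) {x : V × ℤ} {u : List (V × ℤ)}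
    (hx : Γ.IsSyllable x) (hu : Γ.IsMinimal s u) (hr : ¬ IsReflectionOf s (s x.1) u) :
    Γ.IsMinimal s (x :: u) := by
  refine ⟨List.forall_mem_cons.2 ⟨hx, hu.1⟩, fun w'' hw'' => ?_⟩
  -- A competitor need not consist of syllables. The cocycle still finds in it a letter with
  -- reflection `s x.1` and exponent congruent to `x.2`; deleting this letter leaves a word for the
  -- element of `u`, hence at least as long as `u`.
  obtain ⟨w, hwp, hws⟩ := exists_isShortest s (x :: u)
  refine le_trans ?_ (hws w'' (hw''.trans hwp.symm))
  have hc : (s x.1 ^ x.2)⁻¹ * s x.1 * s x.1 ^ x.2 = s x.1 := by group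
  have hN : h.cocycle (Γ.order x.1) (wordProd s w) (s x.1) = x.2 := by
    rw [hwp, wordProd_cons, cocycle_mul, cocycle_zpow, if_pos ⟨rfl, rfl⟩, hc,
      h.cocycle_eq_zero _ hr, add_zero]
  have hrw : IsReflectionOf s (s x.1) w := by
    by_contra hrw
    rw [h.cocycle_eq_zero _ hrw] at hN
    exact hx.cast_ne_zero hN.symm
  obtain ⟨w₁, y, w₂, rfl, hy⟩ := hrw
  rw [h.cocycle_reflection _ hws hy] at hN
  have ho : Γ.order y.1 = Γ.order x.1 := by
    by_contra hne
    rw [if_neg hne] at hN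
    exact hx.cast_ne_zero hN.symm
  rw [if_pos ho, ZMod.intCast_eq_intCast_iff_dvd_sub] at hN
  have hp : wordProd s (w₁ ++ w₂) = wordProd s u := by
    rw [wordProd_exchange hy, wordProd_cons, ← h.zpow_eq_zpow hN] at hwp
    exact mul_left_cancel hwp
  have := hu.2 _ hp
  simp only [List.length_cons, List.length_append] at this ⊢
  omega

/-- If `s v` is a reflection of a minimal word `w`, then `w` can be replaced by a minimal word that
starts with a power of `s v`. -/
theorem exists_cons_of_isReflectionOf (h : Γ.IsAssociatedWith s) {v : V} {w : List (V × ℤ)}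
    (hw : Γ.IsMinimal s w) (hr : IsReflectionOf s (s v) w) :
    ∃ (c : ℤ) (u : List (V × ℤ)), Γ.IsMinimal s ((v, c) :: u) ∧
      wordProd s ((v, c) :: u) = wordProd s w ∧ wordWeight ((v, c) :: u) = wordWeight w := by
  obtain ⟨w₁, y, w₂, rfl, hy⟩ := hr
  have hp : wordProd s ((v, y.2) :: (w₁ ++ w₂)) = wordProd s (w₁ ++ y :: w₂) := by
    rw [wordProd_exchange hy, wordProd_cons]
  have hs : IsShortest s ((v, y.2) :: (w₁ ++ w₂)) := hw.2.congr hp (by simp; omega)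
  refine ⟨y.2, w₁ ++ w₂, ⟨?_, hs⟩, hp, by simp; omega⟩
  have hy' : Γ.IsSyllable y := hw.1 y (by simp)
  -- Both words read off the exponent at `s v`; if the orders differed, one reading would vanish.
  -- Equal orders make the moved letter a syllable.
  have ho : Γ.order v = Γ.order y.1 := by
    have h1 := h.cocycle_reflection (Γ.order y.1) hw.2 hy
    have h2 := h.cocycle_reflection (Γ.order y.1) (w₁ := []) (r := s v) hs (by simp)
    simp only [List.nil_append] at h2
    rw [hp, h1, if_pos rfl] at h2
    by_contra hne
    rw [if_neg hne] at h2
    exact hy'.cast_ne_zero h2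
  intro z hz
  rcases List.mem_cons.1 hz with rfl | hz
  · simpa only [IsSyllable, ho] using hy'
  · apply hw.1
    simp only [List.mem_append, List.mem_cons] at hz ⊢
    tauto

theorem exists_isMinimal_mul_aux (h : Γ.IsAssociatedWith s) {u : List (V × ℤ)}
    (hu : Γ.IsMinimal s u) (v : V) (hr : ¬ IsReflectionOf s (s v) u) (e : ℤ) :
    ∃ w, Γ.IsMinimal s w ∧ wordProd s w = s v ^ e * wordProd s u ∧
      wordWeight w ≤ e.natAbs + wordWeight u := by
  by_cases he : (Γ.order v : ℤ) ∣ e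
  · refine ⟨u, hu, ?_, by omega⟩
    rw [h.zpow_eq_zpow (b := 0) (by simpa using he)]
    simp
  · obtain ⟨b, hb, hd, hle⟩ := exists_isSyllable v he
    refine ⟨(v, b) :: u, h.isMinimal_cons hb hu hr, ?_, ?_⟩
    · rw [wordProd_cons, h.zpow_eq_zpow hd]
    · rw [wordWeight_cons]
      exact Nat.add_le_add_right hle _

/-- Any power of `s v` inside `u` is first brought to the front, where the exponents add; the weight
is then subadditive. -/
theorem exists_isMinimal_mul (h : Γ.IsAssociatedWith s) {u : List (V × ℤ)}
    (hu : Γ.IsMinimal s u) (v : V) (e : ℤ) :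
    ∃ w, Γ.IsMinimal s w ∧ wordProd s w = s v ^ e * wordProd s u ∧
      wordWeight w ≤ e.natAbs + wordWeight u := by
  by_cases hr : IsReflectionOf s (s v) u
  · obtain ⟨c, t, ht, hp, hw⟩ := h.exists_cons_of_isReflectionOf hu hr
    have ht' : Γ.IsMinimal s t := ⟨fun x hx => ht.1 x (List.mem_cons_of_mem _ hx), ht.2.tail⟩
    obtain ⟨w, h1, h2, h3⟩ := h.exists_isMinimal_mul_aux ht' v
      (not_isReflectionOf_right (w₁ := []) ht.2) (e + c)
    refine ⟨w, h1, ?_, ?_⟩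
    · rw [h2, ← hp, wordProd_cons, zpow_add, mul_assoc]
    · rw [← hw, wordWeight_cons]
      have := Int.natAbs_add_le e c
      simp only
      omega
  · exact h.exists_isMinimal_mul_aux hu v hr e

/-- Two minimal words of an element with distinct first letters `x`, `y` allow minimal words that
start with `[x, y]_j`. -/
theorem exists_isMinimal_alternatingList (h : Γ.IsAssociatedWith s) {x y : V × ℤ}
    {t₁ t₂ : List (V × ℤ)} (hne : x.1 ≠ y.1) (h₁ : Γ.IsMinimal s (x :: t₁))
    (h₂ : Γ.IsMinimal s (y :: t₂)) (he : wordProd s (x :: t₁) = wordProd s (y :: t₂)) {j : ℕ}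
    (hj : 1 ≤ j) (hjl : (j : ℕ∞) ≤ Γ.label x.1 y.1) :
    ∃ r, Γ.IsMinimal s (alternatingList x y j ++ r) ∧
      wordProd s (alternatingList x y j ++ r) = wordProd s (x :: t₁) := by
  induction j, hj using Nat.le_induction generalizing x y t₁ t₂ with
  | base => exact ⟨t₁, h₁, rfl⟩
  | succ j hj ih =>
    have hlt : (j : ℕ∞) < Γ.label x.1 y.1 :=
      lt_of_lt_of_le (by exact_mod_cast Nat.lt_succ_self j) hjl
    obtain ⟨r, hr, hrp⟩ := ih hne.symm h₂ h₁ he.symm (by rw [label_comm]; exact hlt.le)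
    have hx := h₁.1 x (by simp)
    have hy := h₂.1 y (by simp)
    obtain ⟨w₁, v, w₂, hw, hv⟩ := h.exists_split hx h₁.2 hr (hrp.trans he.symm)
    have hex := wordProd_exchange (w₂ := w₂) (x := (v, x.2)) hv
    rw [← hw] at hex
    -- The letter with reflection `s x.1` cannot lie in the prefix `[y, x]_j`: that would give `[x,
    -- y]_(i+1) = [y, x]_(i+1)` with `i + 1` below the label. So it lies in `r`, and moving it to
    -- the front yields the prefix `[x, y]_(j+1)`.
    have hcontra : ∀ q, alternatingList y x j ≠ w₁ ++ (v, x.2) :: q := by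
      intro q hq
      obtain ⟨i, hi, h3, h4⟩ := alternatingList_eq_append_cons hq
      have h5 : s x.1 ^ x.2 * wordProd s w₁ = wordProd s (w₁ ++ [(v, x.2)]) := by
        rw [hv, conj_zpow]
        simp
      rw [h4, h3, ← wordProd_cons, ← alternatingList_succ, wordProd_alternatingList,
        wordProd_alternatingList] at h5
      refine h.alternatingProd_ne hne hx.not_dvd hy.not_dvd (Nat.succ_pos i) ?_ h5
      exact lt_of_le_of_lt (by exact_mod_cast hi) hlt
    obtain ⟨r₁, rfl, hr₁⟩ : ∃ r₁, w₁ = alternatingList y x j ++ r₁ ∧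
        r = r₁ ++ (v, x.2) :: w₂ := by
      rcases List.append_eq_append_iff.1 hw with ⟨l, hl, hl'⟩ | ⟨l, hl, hl'⟩
      · exact ⟨l, hl, hl'⟩
      · cases l with
        | nil => exact ⟨[], by simpa using hl.symm, by simpa using hl'.symm⟩
        | cons z l =>
          rw [List.cons_append, List.cons.injEq] at hl'
          rw [← hl'.1] at hl
          exact absurd hl (hcontra l)
    have hp : wordProd s (alternatingList x y (j + 1) ++ (r₁ ++ w₂)) =
        wordProd s (alternatingList y x j ++ r) := by
      rw [hex, alternatingList_succ, List.cons_append, wordProd_cons, List.append_assoc]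
    refine ⟨r₁ ++ w₂, ⟨?_, hr.2.congr hp ?_⟩, hp.trans (hrp.trans he.symm)⟩
    · intro z hz
      rcases List.mem_append.1 hz with hz | hz
      · rcases mem_alternatingList hz with rfl | rfl
        · exact hx
        · exact hy
      · apply hr.1
        rw [hr₁]
        simp only [List.mem_append, List.mem_cons] at hz ⊢
        tauto
    · rw [hr₁]
      simp
      omega

/-- Any two minimal words of an element are connected by elementary moves. -/
theorem reflTransGen_of_wordProd_eq (h : Γ.IsAssociatedWith s) {w₁ w₂ : List (V × ℤ)}
    (h₁ : Γ.IsMinimal s w₁) (h₂ : Γ.IsMinimal s w₂) (he : wordProd s w₁ = wordProd s w₂) :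
    Relation.ReflTransGen Γ.BraidStep w₁ w₂ := by
  induction hn : w₁.length generalizing w₁ w₂ with
  | zero =>
    obtain rfl := List.eq_nil_of_length_eq_zero hn
    have := h₂.2 [] he
    obtain rfl := List.eq_nil_of_length_eq_zero (Nat.le_zero.1 this)
    exact Relation.ReflTransGen.refl
  | succ n ih =>
    have hlen : w₁.length = w₂.length := le_antisymm (h₁.2 _ he.symm) (h₂.2 _ he)
    have same : ∀ {x : V × ℤ} {t₁ t₂ : List (V × ℤ)}, Γ.IsMinimal s (x :: t₁) →
        Γ.IsMinimal s (x :: t₂) → wordProd s (x :: t₁) = wordProd s (x :: t₂) →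
        t₁.length = n → Relation.ReflTransGen Γ.BraidStep (x :: t₁) (x :: t₂) := by
      intro x t₁ t₂ a₁ a₂ ae hl
      rw [wordProd_cons, wordProd_cons] at ae
      refine (ih ⟨fun z hz => a₁.1 z (List.mem_cons_of_mem _ hz), a₁.2.tail⟩
        ⟨fun z hz => a₂.1 z (List.mem_cons_of_mem _ hz), a₂.2.tail⟩
        (mul_left_cancel ae) hl).lift (x :: ·) fun a b hab => hab.cons x
    match w₁, w₂, hlen, hn with
    | x :: t₁, y :: t₂, hlen, hn =>
      have hx := h₁.1 x (by simp)
      have hy := h₂.1 y (by simp)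
      simp only [List.length_cons, Nat.add_right_cancel_iff] at hlen hn
      by_cases hxy : x.1 = y.1
      · have e1 := h.cocycle_reflection (Γ.order x.1) (w₁ := []) (r := s x.1) h₁.2 (by simp)
        have e2 := h.cocycle_reflection (Γ.order x.1) (w₁ := []) (r := s x.1) h₂.2 (by simp [hxy])
        simp only [List.nil_append] at e1 e2
        rw [if_pos trivial, he, e2, if_pos (by rw [hxy])] at e1
        have : x = y := Prod.ext hxy (hx.eq_of_cast_eq hy (by rw [hxy]) e1.symm)
        subst this
        exact same h₁ h₂ he hn
      · cases hl : Γ.label x.1 y.1 with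
        | top =>
          -- An infinite label would allow an alternating prefix of length `n + 2`, longer than the
          -- minimal length `n + 1`.
          obtain ⟨r, hr, hrp⟩ := h.exists_isMinimal_alternatingList hxy h₁ h₂ he
            (j := n + 2) (by omega) (by rw [hl]; exact le_top)
          have := hr.2 _ hrp.symm
          simp at this
          omega
        | coe k =>
          have hk : 2 ≤ k := by
            have := two_le_label (Γ := Γ) x.1 y.1
            rw [hl] at this
            exact_mod_cast this
          obtain ⟨r, hr, hrp⟩ := h.exists_isMinimal_alternatingList hxy h₁ h₂ he
            (j := k) (by omega) hl.ge
          have hstep : Γ.BraidStep (alternatingList x y k ++ r) (alternatingList y x k ++ r) :=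
            ⟨[], r, x, y, k, hxy, hl, rfl, rfl⟩
          have hp : wordProd s (alternatingList y x k ++ r) =
              wordProd s (alternatingList x y k ++ r) := by
            rw [wordProd_append, wordProd_append, wordProd_alternatingList,
              wordProd_alternatingList,
              h.alternatingProd_zpow_eq hxy hx.not_dvd hy.not_dvd hl]
          have hr' : Γ.IsMinimal s (alternatingList y x k ++ r) :=
            ⟨hstep.isSyllable hr.1, hr.2.congr hp (by simp)⟩
          have hlr : (alternatingList x y k ++ r).length = n + 1 := by
            rw [← hn, ← List.length_cons (a := x)]
            exact le_antisymm (hr.2 _ hrp.symm) (h₁.2 _ hrp)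
          obtain ⟨k, rfl⟩ := Nat.exists_eq_add_of_le' (Nat.one_le_iff_ne_zero.2 (by omega : k ≠ 0))
          have hlr' : (alternatingList x y k ++ r).length = n := by
            simp only [List.length_append, length_alternatingList] at hlr ⊢
            omega
          -- The chain is `w₁`, `[x, y]_k r`, `[y, x]_k r`, `w₂`; the outer pairs share their first
          -- letter, so induction joins them.
          exact ((same h₁ hr hrp.symm hn).tail hstep).trans
            (same hr' h₂ (hp.trans (hrp.trans he)) hlr')

end IsAssociatedWith
end DyerGraph

end

noncomputable section

/-! ### Transfer of minimal words along a comparison of Dyer graphs. -/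

namespace DyerGraph

variable {V : Type u} {V' : Type v} {Γ : DyerGraph V} {Γ' : DyerGraph V'}

/-- The comparison of Dyer graphs in terms of the orders of the generators and of the labels. -/
theorem LE.exists_map (hle : Γ.LE Γ') : ∃ φ : V → V', Function.Injective φ ∧
    (∀ x : V × ℤ, Γ.IsSyllable x → Γ'.IsSyllable (Prod.map φ id x)) ∧
    ∀ u v, Γ.label u v ≤ Γ'.label (φ u) (φ v) := by
  obtain ⟨φ, hφ, hv, he⟩ := hle
  refine ⟨φ, hφ, fun x hx => ⟨hx.1, fun h0 => ?_⟩, fun u v => ?_⟩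
  · have hw := hv x.1
    have hx2 := hx.2
    simp only [Prod.map_fst, Prod.map_snd, id] at h0 ⊢
    unfold order at *
    cases hw' : Γ'.vertexWeight (φ x.1) with
    | top => simp [hw'] at h0
    | coe k' =>
      cases hwx : Γ.vertexWeight x.1 with
      | top => simp [hwx, hw'] at hw
      | coe k =>
        have h2 := Γ.two_le_vertexWeight x.1
        rw [hwx] at hw hx2 h2
        rw [hw'] at hw
        have hk : k ≤ k' := by exact_mod_cast hw
        have hk2 : 2 ≤ k := by exact_mod_cast h2
        simp only [ENat.toNat_natCast] at hx2 ⊢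
        have := hx2 (by omega)
        omega
  · by_cases h : Γ.graph.Adj u v
    · rw [label_of_adj h, label_of_adj (φ.map_adj h)]
      exact he ⟨s(u, v), h⟩
    · rw [label_of_not_adj h]
      exact two_le_label _ _

theorem eq_alternatingList_of_map_eq {α : Type u} {β : Type v} {f : α → β}
    (hf : Function.Injective f) {m : List α} {x y : β} {k : ℕ} (hk : 2 ≤ k)
    (h : m.map f = alternatingList x y k) :
    ∃ a b, x = f a ∧ y = f b ∧ m = alternatingList a b k := by
  obtain ⟨a, -, ha⟩ := List.mem_map.1 (h ▸ (mem_alternatingList_iff hk).2 (Or.inl rfl) : x ∈ m.map f)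
  obtain ⟨b, -, hb⟩ := List.mem_map.1 (h ▸ (mem_alternatingList_iff hk).2 (Or.inr rfl) : y ∈ m.map f)
  refine ⟨a, b, ha.symm, hb.symm, hf.list_map ?_⟩
  rw [h, map_alternatingList, ha, hb]

namespace IsAssociatedWith

variable {D : Type w} [Group D] {s : V → D}

/-- A shortest word contains no alternating word that is longer than the label. -/
theorem le_label_of_isShortest (h : Γ.IsAssociatedWith s) {x y : V × ℤ} (hne : x.1 ≠ y.1)
    (hx : Γ.IsSyllable x) (hy : Γ.IsSyllable y) {k : ℕ}
    (hs : IsShortest s (alternatingList x y k)) : (k : ℕ∞) ≤ Γ.label x.1 y.1 := by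
  by_contra! hlt
  cases hl : Γ.label x.1 y.1 with
  | top => simp [hl] at hlt
  | coe m =>
    have hm : 2 ≤ m := by
      have := two_le_label (Γ := Γ) x.1 y.1
      rw [hl] at this
      exact_mod_cast this
    have hmk : m < k := by rw [hl] at hlt; exact_mod_cast hlt
    obtain ⟨l, hl'⟩ := alternatingList_prefix x y (Nat.succ_le_of_lt hmk)
    have hs' : IsShortest s (alternatingList x y (m + 1)) :=
      IsShortest.of_infix (w₁ := []) (w₂ := l) (by rw [List.nil_append, ← hl']; exact hs)
    have hrel := h.alternatingProd_zpow_eq hne hx.not_dvd hy.not_dvd hl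
    obtain ⟨m, rfl⟩ := Nat.exists_eq_add_of_le' (Nat.one_le_iff_ne_zero.2 (by omega : m ≠ 0))
    -- Applying the relation after the first letter produces two adjacent letters `x`, which merge.
    have := hs' ((x.1, x.2 + x.2) :: alternatingList y x m) (by
      rw [wordProd_cons, wordProd_alternatingList, wordProd_alternatingList, alternatingProd_succ,
        ← hrel, alternatingProd_succ, zpow_add, mul_assoc])
    simp at this

/-- The move pulls back because `k ≤ Γ.label ≤ Γ'.label = k`: the first inequality is minimality of
`w`, the second the comparison of the graphs. -/
theorem exists_of_braidStep (h : Γ.IsAssociatedWith s) {φ : V → V'} (hφ : Function.Injective φ)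
    (hlab : ∀ u v, Γ.label u v ≤ Γ'.label (φ u) (φ v)) {w : List (V × ℤ)} {z : List (V' × ℤ)}
    (hw : Γ.IsMinimal s w) (hz : Γ'.BraidStep (w.map (Prod.map φ id)) z) :
    ∃ w', z = w'.map (Prod.map φ id) ∧ Γ.IsMinimal s w' ∧ wordProd s w' = wordProd s w := by
  obtain ⟨l₁, l₂, x', y', k, hne, hk, hwl, rfl⟩ := hz
  have hk2 : 2 ≤ k := by
    have := two_le_label (Γ := Γ') x'.1 y'.1
    rw [hk] at this
    exact_mod_cast this
  obtain ⟨m₁₂, m₃, rfl, h₁₂, rfl⟩ := List.map_eq_append_iff.1 hwl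
  obtain ⟨m₁, m₂, rfl, rfl, h₂⟩ := List.map_eq_append_iff.1 h₁₂
  obtain ⟨x, y, rfl, rfl, rfl⟩ :=
    eq_alternatingList_of_map_eq (hφ.prodMap Function.injective_id) hk2 h₂
  have hx : Γ.IsSyllable x := hw.1 x (by simp [mem_alternatingList_iff hk2])
  have hy : Γ.IsSyllable y := hw.1 y (by simp [mem_alternatingList_iff hk2])
  have hne' : x.1 ≠ y.1 := fun e => hne (by simp [e])
  have hlk : Γ.label x.1 y.1 = k :=
    le_antisymm (hk ▸ hlab x.1 y.1) (h.le_label_of_isShortest hne' hx hy hw.2.of_infix)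
  have hstep : Γ.BraidStep (m₁ ++ alternatingList x y k ++ m₃)
      (m₁ ++ alternatingList y x k ++ m₃) := ⟨m₁, m₃, x, y, k, hne', hlk, rfl, rfl⟩
  have hp : wordProd s (m₁ ++ alternatingList y x k ++ m₃) =
      wordProd s (m₁ ++ alternatingList x y k ++ m₃) := by
    simp only [wordProd_append, wordProd_alternatingList,
      h.alternatingProd_zpow_eq hne' hx.not_dvd hy.not_dvd hlk]
  exact ⟨_, by simp [map_alternatingList], ⟨hstep.isSyllable hw.1, hw.2.congr hp (by simp)⟩, hp⟩

theorem exists_of_reflTransGen (h : Γ.IsAssociatedWith s) {φ : V → V'}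
    (hφ : Function.Injective φ) (hlab : ∀ u v, Γ.label u v ≤ Γ'.label (φ u) (φ v))
    {w : List (V × ℤ)} {z : List (V' × ℤ)} (hw : Γ.IsMinimal s w)
    (hz : Relation.ReflTransGen Γ'.BraidStep (w.map (Prod.map φ id)) z) :
    ∃ w', z = w'.map (Prod.map φ id) ∧ Γ.IsMinimal s w' ∧ wordProd s w' = wordProd s w := by
  induction hz with
  | refl => exact ⟨w, rfl, hw, rfl⟩
  | tail _ hstep ih =>
    obtain ⟨w', rfl, hw', hp⟩ := ih
    obtain ⟨w'', hz, hw'', hp'⟩ := h.exists_of_braidStep hφ hlab hw' hstep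
    exact ⟨w'', hz, hw'', hp'.trans hp⟩

variable {D' : Type*} [Group D'] {s' : V' → D'}

/-- Minimal words remain minimal in the larger Dyer group. -/
theorem isMinimal_map (h : Γ.IsAssociatedWith s) (h' : Γ'.IsAssociatedWith s') {φ : V → V'}
    (hφ : Function.Injective φ)
    (hsyl : ∀ x : V × ℤ, Γ.IsSyllable x → Γ'.IsSyllable (Prod.map φ id x))
    (hlab : ∀ u v, Γ.label u v ≤ Γ'.label (φ u) (φ v)) {w : List (V × ℤ)}
    (hw : Γ.IsMinimal s w) : Γ'.IsMinimal s' (w.map (Prod.map φ id)) := by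
  induction w with
  | nil => exact ⟨by simp, fun w' _ => Nat.zero_le _⟩
  | cons x u ih =>
    have hu : Γ.IsMinimal s u := ⟨fun z hz => hw.1 z (List.mem_cons_of_mem _ hz), hw.2.tail⟩
    refine h'.isMinimal_cons (hsyl x (hw.1 x (by simp))) (ih hu) fun hr => ?_
    obtain ⟨c, t, ht, hp, -⟩ := h'.exists_cons_of_isReflectionOf (ih hu) hr
    -- The moves pull back to a minimal word of the same element as `u` that starts with a power of
    -- `s x.1`; merging it with `x` contradicts minimality of `x :: u`.
    obtain ⟨u', hu', hmin, hpu⟩ := h.exists_of_reflTransGen hφ hlab hu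
      (h'.reflTransGen_of_wordProd_eq (ih hu) ht hp.symm)
    match u', hu' with
    | y :: t', hu' =>
      rw [List.map_cons, List.cons.injEq] at hu'
      have hy : x.1 = y.1 := hφ (congrArg Prod.fst hu'.1)
      have h1 := hw.2 ((x.1, x.2 + y.2) :: t') (by
        rw [wordProd_cons, wordProd_cons, ← hpu, wordProd_cons, zpow_add, mul_assoc, hy])
      have h2 := hmin.2 u hpu.symm
      simp only [List.length_cons] at h1 h2
      omega

/-- Minimal words that represent the same element of the larger Dyer group represent the same
element of the smaller one. -/
theorem wordProd_eq_of_map (h : Γ.IsAssociatedWith s) (h' : Γ'.IsAssociatedWith s') {φ : V → V'}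
    (hφ : Function.Injective φ)
    (hsyl : ∀ x : V × ℤ, Γ.IsSyllable x → Γ'.IsSyllable (Prod.map φ id x))
    (hlab : ∀ u v, Γ.label u v ≤ Γ'.label (φ u) (φ v)) {w₁ w₂ : List (V × ℤ)}
    (h₁ : Γ.IsMinimal s w₁) (h₂ : Γ.IsMinimal s w₂)
    (he : wordProd s' (w₁.map (Prod.map φ id)) = wordProd s' (w₂.map (Prod.map φ id))) :
    wordProd s w₁ = wordProd s w₂ := by
  obtain ⟨w, hw, -, hp⟩ := h.exists_of_reflTransGen hφ hlab h₁
    (h'.reflTransGen_of_wordProd_eq (h.isMinimal_map h' hφ hsyl hlab h₁)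
      (h.isMinimal_map h' hφ hsyl hlab h₂) he)
  rw [(hφ.prodMap Function.injective_id).list_map hw, hp]

end IsAssociatedWith

/-! ### Word length as the weight of a minimal word. -/

section WordLength

variable {n : ℕ} {Γ : DyerGraph (Fin n)} {D : Type u} [Group D] {s : Fin n → D}

theorem wordLength_wordProd_le (w : List (Fin n × ℤ)) :
    Marked.wordLength s (wordProd s w) ≤ wordWeight w := by
  suffices ∃ l, Marked.IsWordFor s l (wordProd s w) ∧ l.length = wordWeight w by
    obtain ⟨l, hl, hw⟩ := this
    exact hw ▸ Marked.wordLength_le_length hl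
  induction w with
  | nil => exact ⟨[], ⟨by simp, rfl⟩, rfl⟩
  | cons x w ih =>
    obtain ⟨l, ⟨hl, hp⟩, hw⟩ := ih
    obtain ⟨y, hy, hxy⟩ : ∃ y : D, (y ∈ Set.range s ∨ y⁻¹ ∈ Set.range s) ∧
        y ^ x.2.natAbs = s x.1 ^ x.2 := by
      rcases Int.natAbs_eq x.2 with hx | hx
      · exact ⟨s x.1, Or.inl ⟨_, rfl⟩, by rw [← zpow_natCast, ← hx]⟩
      · refine ⟨(s x.1)⁻¹, Or.inr ⟨x.1, (inv_inv _).symm⟩, ?_⟩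
        rw [inv_pow, ← zpow_natCast, ← zpow_neg, ← hx]
    refine ⟨List.replicate x.2.natAbs y ++ l, ⟨fun z hz => ?_, ?_⟩, ?_⟩
    · rcases List.mem_append.1 hz with hz | hz
      · rw [List.eq_of_mem_replicate hz]
        exact hy
      · exact hl z hz
    · rw [List.prod_append, List.prod_replicate, hp, hxy, wordProd_cons]
    · rw [List.length_append, List.length_replicate, hw, wordWeight_cons]

/-- Every element has a minimal word whose weight is the word length. -/
theorem IsAssociatedWith.exists_isMinimal (h : Γ.IsAssociatedWith s) (g : D) :
    ∃ w, Γ.IsMinimal s w ∧ wordProd s w = g ∧ wordWeight w = Marked.wordLength s g := by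
  obtain ⟨l, ⟨hl, rfl⟩, hlen⟩ := Marked.exists_word h.closure_range g
  obtain ⟨w, hw, hp, hle⟩ : ∃ w, Γ.IsMinimal s w ∧ wordProd s w = l.prod ∧
      wordWeight w ≤ l.length := by
    clear hlen
    induction l with
    | nil => exact ⟨[], ⟨by simp, fun w' _ => Nat.zero_le _⟩, rfl, le_rfl⟩
    | cons y l ih =>
      obtain ⟨w, hw, hp, hle⟩ := ih fun z hz => hl z (List.mem_cons_of_mem _ hz)
      obtain ⟨v, e, he, hy⟩ : ∃ (v : Fin n) (e : ℤ), e.natAbs = 1 ∧ s v ^ e = y := by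
        rcases hl y (by simp) with ⟨v, rfl⟩ | ⟨v, hv⟩
        · exact ⟨v, 1, rfl, zpow_one _⟩
        · exact ⟨v, -1, rfl, by rw [zpow_neg_one, hv, inv_inv]⟩
      obtain ⟨w', h1, h2, h3⟩ := h.exists_isMinimal_mul hw v e
      refine ⟨w', h1, by rw [h2, hy, hp, List.prod_cons], ?_⟩
      rw [List.length_cons]
      omega
  exact ⟨w, hw, hp, le_antisymm (hlen ▸ hle) (hp ▸ wordLength_wordProd_le w)⟩

/-- Some minimal word has weight equal to the word length, and elementary moves carry this weight to
all the others. -/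
theorem IsAssociatedWith.wordLength_wordProd (h : Γ.IsAssociatedWith s) {w : List (Fin n × ℤ)}
    (hw : Γ.IsMinimal s w) : Marked.wordLength s (wordProd s w) = wordWeight w := by
  obtain ⟨w', hw', hp, hl⟩ := h.exists_isMinimal (wordProd s w)
  rw [← hl]
  exact wordWeight_eq_of_reflTransGen (h.reflTransGen_of_wordProd_eq hw' hw hp) hw'.1

/-- The smaller Dyer group embeds, as a set, into the larger one such that word lengths are
preserved. -/
theorem IsAssociatedWith.exists_injective {n' : ℕ} {Γ' : DyerGraph (Fin n')} {D' : Type v}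
    [Group D'] {s' : Fin n' → D'} (h : Γ.IsAssociatedWith s) (h' : Γ'.IsAssociatedWith s')
    (hle : Γ.LE Γ') : ∃ F : D → D', Function.Injective F ∧
      ∀ g, Marked.wordLength s' (F g) = Marked.wordLength s g := by
  obtain ⟨φ, hφ, hsyl, hlab⟩ := hle.exists_map
  -- The map depends on the chosen words, since a relation of `Γ` may fail in `Γ'`; it need not be a
  -- homomorphism.
  choose W hmin hprod hweight using h.exists_isMinimal
  refine ⟨fun g => wordProd s' ((W g).map (Prod.map φ id)), fun g₁ g₂ he => ?_, fun g => ?_⟩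
  · rw [← hprod g₁, ← hprod g₂]
    exact h.wordProd_eq_of_map h' hφ hsyl hlab (hmin g₁) (hmin g₂) he
  · rw [h'.wordLength_wordProd (h.isMinimal_map h' hφ hsyl hlab (hmin g)), ← hweight g]
    simp [wordWeight, Function.comp_def]

end WordLength
end DyerGraph

end

theorem theoremB {n n' : ℕ} {D : Type u} {D' : Type v} [Group D] [Group D']
    (s : Fin n → D) (s' : Fin n' → D')
    (hs : IsMarkedDyerSystem s) (hs' : IsMarkedDyerSystem s')
    (hle : DyerLE s s') :
    (∀ m : ℕ, Marked.sphereCount s m ≤ Marked.sphereCount s' m) ∧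
      Marked.growthRate s ≤ Marked.growthRate s' := by
  obtain ⟨Γ, Γ', h, h', hΓ⟩ := hle
  obtain ⟨F, hF, hlen⟩ := h.exists_injective h' hΓ
  -- `Set.ncard` is `0` on infinite sets, so comparing cardinalities needs the target to be finite.
  have hfin := Marked.finite_ball hs'.closure_range
  refine ⟨fun m => Set.ncard_le_ncard_of_injOn F (fun x hx => (hlen x).trans hx) hF.injOn
    ((hfin m).subset fun x hx => le_of_eq hx), ?_⟩
  refine le_of_tendsto_of_tendsto' (Marked.tendsto_growthRate hs.closure_range)
    (Marked.tendsto_growthRate hs'.closure_range) fun m => ?_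
  refine Real.rpow_le_rpow (Nat.cast_nonneg _) (Nat.cast_le.2 ?_) (by positivity)
  exact Set.ncard_le_ncard_of_injOn F (fun x hx => (hlen x).trans_le hx) hF.injOn (hfin m)
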